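/- Let $H=A+V$ on $\ell^2(\mathbb Z)$, $$(Hu)_n=\sum_{k\in\mathbb Z}a_k u_{n-k}+V_nu_n,$$ where $|a_n|\le A_1e^{-a|n|}$ for some $a,A_1>0$, $a_{-n}=\overline{a_n}$, and $V=\{V_n\}$ is real and bounded. Let $K$ be such that $\sigma(H)\subset[-K+1,K-1]$. For a finite interval $I\subset\mathbb Z$ let $R_I$ be the restriction to $I$, let $|I|$ be the number of points of $I$, and for $\operatorname{Im}z>0$ let $G_I(z)=(R_I(H-z)R_I)^{-1}$ be the Green's function, with matrix elements $G_I(z)(n,n')$, $n,n'\in I$. Suppose there are $\delta>0$ and $N_0$ such that for every $z=E+i\varepsilon$ with $|E|\le K$ and $0<\varepsilon\le\delta$, every integer $N>N_0$, and each of the two sets $J=[N/4,N/2]$ and $J=[-N/2,-N/4]$, there is an interval $I\subset J$ with $|I|\ge N^\delta$ and $$|G_I(z)(n,n')|\le e^{-|I|^\delta}\quad\text{for all } n,n'\in I \text{ with } |n-n'|\ge \tfrac1{20}|I| .$$ For $\phi\in\ell^2(\mathbb Z)$ and $p,T>0$ let $$\langle|X|^p_\phi\rangle(T)=\frac2T\int_0^\infty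 e^{-2t/T}\sum_{n\in\mathbb Z}|n|^p|(e^{-itH}\phi,\delta_n)|^2\,dt,\qquad \beta^+_\phi(p)=\limsup_{T\to\infty}\frac{\ln\langle|X|^p_\phi\rangle(T)}{p\ln T}\in[-\infty,\infty],$$ with $\ln 0=-\infty$ and $\ln\infty=\infty$. Then for every compactly supported $\phi$ and every $p>0$ one has $\beta^+_\phi(p)\le0$. Moreover $\beta^+_\phi(p)=0$, except in the trivial cases where $\phi=0$, or where $\phi$ is a multiple of $\delta_0$ and $a_k=0$ for all $k\ne0$ (in these cases the moments vanish identically). -/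

import Mathlib

open scoped ENNReal

/-- The Hilbert space `ℓ²(ℤ)`. -/
abbrev SqSeq : Type := lp (fun _ : ℤ => ℂ) 2

/-- Coefficients of a long-range operator `H = A + V` on `ℓ²(ℤ)`: a kernel `a` with
`|a_n| ≤ A₁ e^{-α|n|}` for some `α, A₁ > 0` and `a_{-n} = conj a_n`, and a bounded real
potential `V`. -/
structure LongRangeData where
  a : ℤ → ℂ
  V : ℤ → ℝ
  decay : ∃ A₁ α : ℝ, 0 < A₁ ∧ 0 < α ∧ ∀ n : ℤ, ‖a n‖ ≤ A₁ * Real.exp (-α * |(n : ℝ)|)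
  symm : ∀ n : ℤ, a (-n) = (starRingEnd ℂ) (a n)
  bounded : ∃ C : ℝ, ∀ n : ℤ, |V n| ≤ C

/-- The translation `(S_k u)_n = u_{n-k}`. -/
noncomputable def shiftOp (k : ℤ) : SqSeq →L[ℂ] SqSeq :=
  LinearMap.mkContinuous
    { toFun := fun u => ⟨fun n => u (n - k), by
        have h := (lp.memℓp u).summable (by norm_num)
        exact memℓp_gen (h.comp_injective (Equiv.subRight k).injective)⟩
      map_add' := fun _ _ => rfl
      map_smul' := fun _ _ => rfl } 1 (by
    intro u
    rw [one_mul]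
    refine lp.norm_le_of_tsum_le (by norm_num) (norm_nonneg u) ?_
    rw [lp.norm_rpow_eq_tsum (by norm_num) u]
    exact le_of_eq ((Equiv.subRight k).tsum_eq
      (fun n => ‖u n‖ ^ (2 : ℝ≥0∞).toReal)))

theorem shiftOp_apply (k : ℤ) (u : SqSeq) (n : ℤ) : shiftOp k u n = u (n - k) := rfl

theorem norm_shiftOp_le (k : ℤ) : ‖shiftOp k‖ ≤ 1 :=
  LinearMap.mkContinuous_norm_le _ zero_le_one _

theorem mul_norm_le {V : ℤ → ℝ} {C : ℝ} (hC : ∀ n, |V n| ≤ C) (u : SqSeq) (n : ℤ) :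
    ‖(V n : ℂ) * u n‖ ≤ ‖(C : ℂ) • u n‖ := by
  rw [norm_mul, norm_smul, Complex.norm_real, Complex.norm_real, Real.norm_eq_abs,
    Real.norm_eq_abs]
  exact mul_le_mul_of_nonneg_right ((hC n).trans (le_abs_self C)) (norm_nonneg _)

/-- Multiplication by a bounded real potential, `(V u)_n = V_n u_n`. -/
noncomputable def potentialOp (V : ℤ → ℝ) (hV : ∃ C : ℝ, ∀ n : ℤ, |V n| ≤ C) :
    SqSeq →L[ℂ] SqSeq :=
  LinearMap.mkContinuous
    { toFun := fun u => ⟨fun n => (V n : ℂ) * u n, by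
        obtain ⟨C, hC⟩ := hV
        have h := (lp.memℓp ((C : ℂ) • u)).summable (by norm_num)
        refine memℓp_gen (h.of_nonneg_of_le (fun n => by positivity) (fun n => ?_))
        exact Real.rpow_le_rpow (norm_nonneg _) (mul_norm_le hC u n) (by norm_num)⟩
      map_add' := fun u v => by
        ext n
        exact mul_add _ _ _
      map_smul' := fun c u => by
        ext n
        exact mul_left_comm _ _ _ } |hV.choose| (by
    intro u
    have hC := hV.choose_spec
    have hn : ‖(hV.choose : ℂ) • u‖ = |hV.choose| * ‖u‖ := by
      rw [norm_smul, Complex.norm_real, Real.norm_eq_abs]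
    rw [← hn]
    refine lp.norm_mono (by norm_num) (fun n => ?_)
    exact mul_norm_le hC u n)

theorem potentialOp_apply (V : ℤ → ℝ) (hV : ∃ C : ℝ, ∀ n : ℤ, |V n| ≤ C) (u : SqSeq) (n : ℤ) :
    potentialOp V hV u n = (V n : ℂ) * u n := rfl

namespace LongRangeData

/-- The operator `H = A + V`, where `A = ∑_k a_k S_k` (a norm convergent series). -/
noncomputable def H (D : LongRangeData) : SqSeq →L[ℂ] SqSeq :=
  (∑' k : ℤ, D.a k • shiftOp k) + potentialOp D.V D.bounded

theorem summable_norm_a (D : LongRangeData) : Summable (fun k => ‖D.a k‖) := by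
  obtain ⟨A, α, hA, hα, h⟩ := D.decay
  refine Summable.of_nonneg_of_le (fun _ => norm_nonneg _) h (Summable.mul_left A ?_)
  have hs : Summable (fun n : ℕ => Real.exp (-α * |((n : ℤ) : ℝ)|)) := by
    have := Real.summable_exp_nat_mul_iff.mpr (neg_lt_zero.mpr hα)
    refine this.congr (fun n => ?_)
    simp [mul_comm]
  refine Summable.of_nat_of_neg hs (hs.congr (fun n => ?_))
  simp

theorem summable_toeplitz (D : LongRangeData) :
    Summable (fun k : ℤ => D.a k • shiftOp k) := by
  refine Summable.of_norm_bounded D.summable_norm_a (fun k => ?_)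
  rw [norm_smul]
  exact mul_le_of_le_one_right (norm_nonneg _) (norm_shiftOp_le k)

/-- `(H u)_n = ∑_k a_k u_{n-k} + V_n u_n`. -/
theorem H_apply (D : LongRangeData) (u : SqSeq) (n : ℤ) :
    D.H u n = (∑' k : ℤ, D.a k * u (n - k)) + (D.V n : ℂ) * u n := by
  have h1 := (D.summable_toeplitz.hasSum.mapL
    ((lp.evalCLM ℂ (fun _ : ℤ => ℂ) 2 n).comp
      (ContinuousLinearMap.apply ℂ SqSeq u))).tsum_eq
  change ((∑' k : ℤ, D.a k • shiftOp k) u) n + (D.V n : ℂ) * u n = _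
  congr 1
  exact h1.symm

/-- The matrix of `R_I (H - z) R_I` on a finite set `I ⊂ ℤ`, in the basis `(δ_n)_{n ∈ I}`. -/
noncomputable def restrict (D : LongRangeData) (I : Finset ℤ) (z : ℂ) : Matrix I I ℂ :=
  Matrix.of fun n m => (D.H - z • ContinuousLinearMap.id ℂ SqSeq) (lp.single 2 (m : ℤ) (1 : ℂ)) n

/-- The Green's function `G_I(z) = (R_I (H - z) R_I)⁻¹` of a finite set `I ⊂ ℤ`. -/
noncomputable def green (D : LongRangeData) (I : Finset ℤ) (z : ℂ) : Matrix I I ℂ :=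
  (D.restrict I z)⁻¹

/-- `I` is large at scale `N`, and the Green's function of `I` at `z` decays off the diagonal:
`|I| ≥ N^δ`, and `|G_I(z)(n, n')| ≤ e^{-|I|^δ}` if `n, n' ∈ I` and `|n - n'| ≥ |I| / 20`. Here
`|I|` is the number of points of `I`. -/
def GoodBox (D : LongRangeData) (δ : ℝ) (z : ℂ) (N : ℕ) (I : Finset ℤ) : Prop :=
  (N : ℝ) ^ δ ≤ (I.card : ℝ) ∧
    ∀ n n' : I, (I.card : ℝ) / 20 ≤ |(((n : ℤ) : ℝ) - ((n' : ℤ) : ℝ))| →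
      ‖D.green I z n n'‖ ≤ Real.exp (-(I.card : ℝ) ^ δ)

/-- The state `e^{-itH} φ`. -/
noncomputable def evolve (D : LongRangeData) (t : ℝ) (φ : SqSeq) : SqSeq :=
  NormedSpace.exp ((-(Complex.I * (t : ℂ))) • D.H) φ

/-- The time-averaged moment
`(2/T) ∫_0^∞ e^{-2t/T} ∑_n |n|^p |(e^{-itH} φ, δ_n)|² dt`, as a value in `[0, ∞]`. -/
noncomputable def moment (D : LongRangeData) (φ : SqSeq) (p T : ℝ) : ℝ≥0∞ :=
  ENNReal.ofReal (2 / T) *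
    ∫⁻ t in Set.Ioi (0 : ℝ), ENNReal.ofReal (Real.exp (-2 * t / T)) *
      ∑' n : ℤ, ENNReal.ofReal (|(n : ℝ)| ^ p * ‖D.evolve t φ n‖ ^ 2)

/-- The upper transport exponent `limsup_{T → ∞} ln (moment) / (p ln T)`, as an extended real
number, with `ln 0 = -∞` and `ln ∞ = ∞`. -/
noncomputable def upperExponent (D : LongRangeData) (φ : SqSeq) (p : ℝ) : EReal :=
  Filter.limsup
    (fun T : ℝ => ENNReal.log (D.moment φ p T) / ((p * Real.log T : ℝ) : EReal)) Filter.atTop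

end LongRangeData

/-! ### Basic operators on `ℓ²(ℤ)` -/

/-! One good box per side and per scale is enough; no multiscale iteration is needed. Let `(H - z) u
= φ`, and let a good box `I` lie between the support of `φ` and a site `n` with `|n| = N`. On `I`,
`u = -G_I H g`, where `g` is the part of `u` outside `I`. Seen from the middle of `I`, the far
entries of `G_I` are small by hypothesis, and the near ones meet values of `H g` that are small
because the kernel decays exponentially. So `u` is tiny around the centre of `I`
(`norm_apply_le_of_green_le`). If `S` is the half-line beyond this centre, `(H - z) 1_S u = [H, 1_S]
u` involves mainly the values of `u` near the cut, so `1_S u` is tiny as well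
(`norm_apply_le_of_cut`). Since `|I| ≥ N^δ`, the gain is a stretched exponential in `N`, which beats
every power of `N`; the price is `(Im z)⁻³`.

The Cauchy formula transfers this to `e^{-itH} φ`. The contour is a large circle centred at `-iY`,
with `Y` of order `T`. Its upper arc over `|Re z| ≤ K` lies at height between `1/(4T)` and `1/(2T)`;
elsewhere the circle is at distance at least one from the spectrum and Combes–Thomas applies. Hence
`|(e^{-itH} φ)_n| ≤ C T⁴ e^{t/(2T)} |n|^{-M}` for every `M` (`exists_evolve_decay`). For any `s > 0`
the sites `|n| > T^s` then contribute a bounded amount, and the moment is `O(T^{sp})`.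

For the lower bound, the moment dominates the averaged mass off the site `0`. With a nonzero hopping
term this mass cannot be small both at time `t` and at time `t + s` for a suitable fixed `s`
(`exists_le_moment_of_hopping`). Without hopping every `|(e^{-itH} φ)_n|` is constant in time. -/

theorem SqSeq.norm_le_of_norm_apply_le (u v : SqSeq) (h : ∀ n, ‖u n‖ ≤ ‖v n‖) : ‖u‖ ≤ ‖v‖ :=
  lp.norm_mono (by norm_num) h

theorem SqSeq.norm_apply_le (u : SqSeq) (n : ℤ) : ‖u n‖ ≤ ‖u‖ :=
  lp.norm_apply_le_norm (by norm_num) u n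

theorem SqSeq.hasSum_norm_sq (u : SqSeq) : HasSum (fun n => ‖u n‖ ^ 2) (‖u‖ ^ 2) := by
  have := lp.hasSum_norm (p := 2) (by norm_num) u
  simpa using this

theorem SqSeq.norm_le_sum_of_support (u : SqSeq) (s : Finset ℤ) (hs : ∀ n ∉ s, u n = 0) :
    ‖u‖ ≤ ∑ n ∈ s, ‖u n‖ := by
  have h : u = ∑ n ∈ s, lp.single 2 n (u n) := by
    ext m
    rw [lp.coeFn_sum, Finset.sum_apply]
    simp only [lp.single_apply, Pi.single_apply]
    by_cases hm : m ∈ s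
    · simp [hm]
    · simp [hm, hs m hm]
  calc ‖u‖ = ‖∑ n ∈ s, (lp.single 2 n (u n) : SqSeq)‖ := by rw [← h]
    _ ≤ ∑ n ∈ s, ‖(lp.single 2 n (u n) : SqSeq)‖ := norm_sum_le _ _
    _ = ∑ n ∈ s, ‖u n‖ := by
      refine Finset.sum_congr rfl fun n _ => ?_
      exact lp.norm_single (E := fun _ : ℤ => ℂ) (p := 2) (by norm_num) n (u n)

theorem adjoint_shiftOp (k : ℤ) : ContinuousLinearMap.adjoint (shiftOp k) = shiftOp (-k) := by
  symm
  rw [ContinuousLinearMap.eq_adjoint_iff]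
  intro u v
  rw [lp.inner_eq_tsum, lp.inner_eq_tsum]
  rw [← (Equiv.subRight k).tsum_eq]
  refine tsum_congr fun n => ?_
  simp [shiftOp_apply]

theorem isSelfAdjoint_potentialOp (V : ℤ → ℝ) (hV : ∃ C : ℝ, ∀ n : ℤ, |V n| ≤ C) :
    IsSelfAdjoint (potentialOp V hV) := by
  rw [ContinuousLinearMap.isSelfAdjoint_iff', eq_comm, ContinuousLinearMap.eq_adjoint_iff]
  intro u v
  rw [lp.inner_eq_tsum, lp.inner_eq_tsum]
  refine tsum_congr fun n => ?_
  simp only [potentialOp_apply, RCLike.inner_apply, map_mul, Complex.conj_ofReal]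
  ring

/-! ### Self-adjointness and a priori bounds for `H - z`. -/

namespace LongRangeData

theorem isSelfAdjoint_H (D : LongRangeData) : IsSelfAdjoint D.H := by
  refine IsSelfAdjoint.add ?_ (isSelfAdjoint_potentialOp _ _)
  rw [isSelfAdjoint_iff, tsum_star, ← (Equiv.neg ℤ).tsum_eq]
  refine tsum_congr fun k => ?_
  simp only [Equiv.neg_apply, star_smul, ContinuousLinearMap.star_eq_adjoint, adjoint_shiftOp,
    D.symm, neg_neg]
  simp

/-- The spectrum is nonempty, which forces `1 ≤ K`; the norm of a self-adjoint operator is its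
spectral radius. -/
theorem one_le_and_norm_H_le (D : LongRangeData) {K : ℝ}
    (hK : spectrum ℂ D.H ⊆ (fun x : ℝ => (x : ℂ)) '' Set.Icc (-K + 1) (K - 1)) :
    1 ≤ K ∧ ‖D.H‖ ≤ K - 1 := by
  have hnt : Nontrivial SqSeq :=
    ⟨lp.single 2 0 1, 0, fun h => by
      have := congrArg (fun u : SqSeq => u 0) h
      simp at this⟩
  have h1 : 1 ≤ K := by
    obtain ⟨z, hz⟩ := spectrum.nonempty D.H
    obtain ⟨x, hx, -⟩ := hK hz
    linarith [hx.1, hx.2]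
  refine ⟨h1, ?_⟩
  have h2 := D.isSelfAdjoint_H.spectralRadius_eq_nnnorm
  have h3 : spectralRadius ℂ D.H ≤ ENNReal.ofReal (K - 1) := by
    refine iSup₂_le fun z hz => ?_
    obtain ⟨x, hx, rfl⟩ := hK hz
    rw [← enorm_eq_nnnorm, ← ofReal_norm]
    refine ENNReal.ofReal_le_ofReal ?_
    rw [Complex.norm_real, Real.norm_eq_abs, abs_le]
    constructor <;> linarith [hx.1, hx.2]
  rw [h2, ← enorm_eq_nnnorm, ← ofReal_norm] at h3
  exact (ENNReal.ofReal_le_ofReal_iff (by linarith)).1 h3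

theorem inner_H_im (D : LongRangeData) (u : SqSeq) : (inner ℂ u (D.H u)).im = 0 := by
  have := D.isSelfAdjoint_H.isSymmetric
  have h := this.im_inner_self_apply
  simpa using h u

/-- Since `⟨u, H u⟩` is real, `Im ⟨u, (H - z) u⟩ = -Im z ‖u‖²`; Cauchy–Schwarz concludes. -/
theorem im_mul_norm_le (D : LongRangeData) (z : ℂ) (u : SqSeq) :
    |z.im| * ‖u‖ ≤ ‖D.H u - z • u‖ := by
  rcases eq_or_ne u 0 with rfl | hu
  · simp
  have h1 : (inner ℂ u (D.H u - z • u)).im = -(z.im * ‖u‖ ^ 2) := by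
    rw [inner_sub_right, inner_smul_right, inner_self_eq_norm_sq_to_K, Complex.sub_im,
      D.inner_H_im]
    simp [← Complex.ofReal_pow]
  have h2 := (Complex.abs_im_le_norm _).trans (norm_inner_le_norm (𝕜 := ℂ) u (D.H u - z • u))
  rw [h1, abs_neg, abs_mul, abs_of_nonneg (sq_nonneg ‖u‖)] at h2
  have hu' : 0 < ‖u‖ := norm_pos_iff.2 hu
  nlinarith

theorem re_mul_norm_le (D : LongRangeData) (z : ℂ) (u : SqSeq) :
    (|z.re| - ‖D.H‖) * ‖u‖ ≤ ‖D.H u - z • u‖ := by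
  have h1 : ‖z • u‖ ≤ ‖D.H u - z • u‖ + ‖D.H u‖ := by
    have := norm_sub_le (D.H u) (D.H u - z • u)
    rw [sub_sub_cancel] at this
    linarith
  have h2 := D.H.le_opNorm u
  rw [norm_smul] at h1
  nlinarith [Complex.abs_re_le_norm z, norm_nonneg u]

/-! ### Exponential moments of the kernel and commutators -/

theorem exists_exp_moment (D : LongRangeData) :
    ∃ β : ℝ, 0 < β ∧ Summable (fun k : ℤ => ‖D.a k‖ * Real.exp (β * |(k : ℝ)|)) := by
  obtain ⟨A, α, hA, hα, h⟩ := D.decay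
  refine ⟨α / 2, by positivity, ?_⟩
  have hs : Summable (fun n : ℕ => Real.exp (-(α / 2) * |((n : ℤ) : ℝ)|)) := by
    have := Real.summable_exp_nat_mul_iff.mpr (neg_lt_zero.mpr (half_pos hα))
    refine this.congr (fun n => ?_)
    simp [mul_comm]
  have hs' : Summable (fun n : ℤ => Real.exp (-(α / 2) * |(n : ℝ)|)) :=
    Summable.of_nat_of_neg hs (hs.congr (fun n => by simp))
  refine Summable.of_nonneg_of_le (fun _ => by positivity) (fun k => ?_) (hs'.mul_left A)
  calc ‖D.a k‖ * Real.exp (α / 2 * |(k : ℝ)|)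
      ≤ A * Real.exp (-α * |(k : ℝ)|) * Real.exp (α / 2 * |(k : ℝ)|) := by gcongr; exact h k
    _ = A * Real.exp (-(α / 2) * |(k : ℝ)|) := by
      rw [mul_assoc, ← Real.exp_add]; ring_nf

theorem H_apply_eq_tsum (D : LongRangeData) (u : SqSeq) :
    D.H u = (∑' k : ℤ, D.a k • shiftOp k u) + potentialOp D.V D.bounded u := by
  have h1 := (D.summable_toeplitz.hasSum.mapL (ContinuousLinearMap.apply ℂ SqSeq u)).tsum_eq
  change (∑' k : ℤ, D.a k • shiftOp k) u + _ = _
  congr 1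
  exact h1.symm

theorem summable_shiftOp_apply (D : LongRangeData) (u : SqSeq) :
    Summable (fun k : ℤ => D.a k • shiftOp k u) :=
  (D.summable_toeplitz.hasSum.mapL (ContinuousLinearMap.apply ℂ SqSeq u)).summable

/-- A bound for the commutator of `H` with a multiplication operator, from bounds for the
commutators of the translations. -/
theorem norm_commutator_le (D : LongRangeData) {β : ℝ}
    (hβ : Summable (fun k : ℤ => ‖D.a k‖ * Real.exp (β * |(k : ℝ)|)))
    (w : ℤ → ℝ) (hw : ∃ C : ℝ, ∀ n : ℤ, |w n| ≤ C) (u : SqSeq) (B : ℝ)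
    (hB : ∀ k : ℤ, ‖shiftOp k (potentialOp w hw u) - potentialOp w hw (shiftOp k u)‖
      ≤ B * Real.exp (β * |(k : ℝ)|)) :
    ‖D.H (potentialOp w hw u) - potentialOp w hw (D.H u)‖
      ≤ B * ∑' k : ℤ, ‖D.a k‖ * Real.exp (β * |(k : ℝ)|) := by
  have hcomm : potentialOp D.V D.bounded (potentialOp w hw u) =
      potentialOp w hw (potentialOp D.V D.bounded u) := by
    ext n
    simp only [potentialOp_apply]
    ring
  have h1 : D.H (potentialOp w hw u) - potentialOp w hw (D.H u) =
      ∑' k : ℤ, D.a k • (shiftOp k (potentialOp w hw u) - potentialOp w hw (shiftOp k u)) := by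
    rw [H_apply_eq_tsum, H_apply_eq_tsum, map_add, hcomm, add_sub_add_right_eq_sub,
      ContinuousLinearMap.map_tsum _ (D.summable_shiftOp_apply u),
      ← Summable.tsum_sub (D.summable_shiftOp_apply _)
        ((D.summable_shiftOp_apply u).mapL (potentialOp w hw))]
    refine tsum_congr fun k => ?_
    rw [map_smul, smul_sub]
  rw [h1, ← tsum_mul_left]
  refine tsum_of_norm_bounded (hβ.mul_left B).hasSum fun k => ?_
  rw [norm_smul]
  calc _ ≤ ‖D.a k‖ * (B * Real.exp (β * |(k : ℝ)|)) := by gcongr; exact hB k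
    _ = _ := by ring

/-- The Combes–Thomas estimate at spectral parameters at distance at least one from the numerical
range. -/
theorem exists_combesThomas (D : LongRangeData) :
    ∃ θ : ℝ, 0 < θ ∧ ∀ (z : ℂ) (φ u : SqSeq) (m : ℝ), (∀ v : SqSeq, ‖v‖ ≤ ‖D.H v - z • v‖) →
      (∀ n : ℤ, m < |(n : ℝ)| → φ n = 0) → 0 ≤ m → D.H u - z • u = φ →
      ∀ n : ℤ, ‖u n‖ ≤ 2 * Real.exp (θ * m) * ‖φ‖ * Real.exp (-θ * |(n : ℝ)|) := by
  obtain ⟨β, hβ0, hβ⟩ := D.exists_exp_moment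
  set C := ∑' k : ℤ, ‖D.a k‖ * Real.exp (β * |(k : ℝ)|) with hC
  have hC0 : 0 ≤ C := tsum_nonneg fun _ => by positivity
  -- The commutator of `H` with the weight `W` will be at most `(2θ/β) C ‖W u‖`; this choice lets
  -- half of `‖W u‖` absorb it.
  obtain ⟨θ, hθ0, hθβ, hθC⟩ : ∃ θ : ℝ, 0 < θ ∧ θ ≤ β / 2 ∧ 2 * θ / β * C ≤ 1 / 2 := by
    refine ⟨min (β / 2) (β / (4 * C + 4)), by positivity, min_le_left _ _, ?_⟩
    calc 2 * min (β / 2) (β / (4 * C + 4)) / β * C ≤ 2 * (β / (4 * C + 4)) / β * C := by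
          gcongr; exact min_le_right _ _
      _ = C / (2 * C + 2) := by field_simp; ring
      _ ≤ 1 / 2 := by rw [div_le_iff₀ (by positivity)]; linarith
  refine ⟨θ, hθ0, fun z φ u m hz hφ hm hu n => ?_⟩
  -- The weight `e^{θ|j|}` is truncated at the height it has at `n`: it becomes bounded, and nothing
  -- is lost at the site `n`, where the estimate is read off.
  have hw : ∃ c : ℝ, ∀ j : ℤ, |Real.exp (θ * min |(j : ℝ)| |(n : ℝ)|)| ≤ c :=
    ⟨Real.exp (θ * |(n : ℝ)|), fun j => by
      rw [Real.abs_exp]; gcongr; exact min_le_right _ _⟩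
  set W := potentialOp (fun j : ℤ => Real.exp (θ * min |(j : ℝ)| |(n : ℝ)|)) hw with hW
  have hWn : ∀ (v : SqSeq) (j : ℤ), ‖W v j‖ = Real.exp (θ * min |(j : ℝ)| |(n : ℝ)|) * ‖v j‖ := by
    intro v j
    rw [hW, potentialOp_apply, norm_mul, Complex.norm_real, Real.norm_eq_abs, Real.abs_exp]
  have hshift : ∀ k : ℤ, ‖shiftOp k (W u) - W (shiftOp k u)‖
      ≤ 2 * θ / β * ‖W u‖ * Real.exp (β * |(k : ℝ)|) := by
    intro k
    have he : 0 ≤ Real.exp (θ * |(k : ℝ)|) - 1 := by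
      rw [sub_nonneg]; exact Real.one_le_exp (by positivity)
    have h1 : ‖shiftOp k (W u) - W (shiftOp k u)‖ ≤ (Real.exp (θ * |(k : ℝ)|) - 1) * ‖W u‖ := by
      calc _ ≤ ‖((Real.exp (θ * |(k : ℝ)|) - 1 : ℝ) : ℂ) • shiftOp k (W u)‖ := by
            refine SqSeq.norm_le_of_norm_apply_le _ _ fun j => ?_
            have e1 : (shiftOp k (W u) - W (shiftOp k u)) j =
                ((Real.exp (θ * min |((j - k : ℤ) : ℝ)| |(n : ℝ)|)
                  - Real.exp (θ * min |(j : ℝ)| |(n : ℝ)|) : ℝ) : ℂ) * u (j - k) := by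
              rw [lp.coeFn_sub, Pi.sub_apply, shiftOp_apply, hW, potentialOp_apply,
                potentialOp_apply, shiftOp_apply]
              push_cast
              ring
            have e2 : (((Real.exp (θ * |(k : ℝ)|) - 1 : ℝ) : ℂ) • shiftOp k (W u)) j =
                ((Real.exp (θ * |(k : ℝ)|) - 1 : ℝ) : ℂ) * W u (j - k) := rfl
            rw [e1, e2, norm_mul, norm_mul, hWn, ← mul_assoc, Complex.norm_real,
              Complex.norm_real, Real.norm_eq_abs, Real.norm_eq_abs, abs_of_nonneg he]
            refine mul_le_mul_of_nonneg_right ?_ (norm_nonneg _)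
            have t1 : |((j - k : ℤ) : ℝ)| ≤ |(j : ℝ)| + |(k : ℝ)| := by
              push_cast; exact abs_sub _ _
            have t2 : |(j : ℝ)| ≤ |((j - k : ℤ) : ℝ)| + |(k : ℝ)| := by
              have := abs_add_le ((j : ℝ) - k) k
              push_cast; simpa using this
            set x := min |((j - k : ℤ) : ℝ)| |(n : ℝ)| with hx
            set y := min |(j : ℝ)| |(n : ℝ)| with hy
            have hyx : y ≤ x + |(k : ℝ)| := by
              rw [hx, hy, ← min_add_add_right]
              exact min_le_min t2 (by linarith [abs_nonneg (k : ℝ)])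
            have hxy : x ≤ y + |(k : ℝ)| := by
              rw [hx, hy, ← min_add_add_right]
              exact min_le_min t1 (by linarith [abs_nonneg (k : ℝ)])
            have f1 : Real.exp (θ * y) ≤ Real.exp (θ * |(k : ℝ)|) * Real.exp (θ * x) := by
              rw [← Real.exp_add]; gcongr; nlinarith
            have f2 : Real.exp (θ * x) ≤ Real.exp (θ * |(k : ℝ)|) * Real.exp (θ * y) := by
              rw [← Real.exp_add]; gcongr; nlinarith
            rw [abs_le]
            constructor
            · linarith
            · rcases le_total (Real.exp (θ * x)) (Real.exp (θ * y)) with h | h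
              · nlinarith [Real.exp_pos (θ * x)]
              · nlinarith [Real.exp_pos (θ * x)]
        _ ≤ _ := by
            rw [norm_smul, Complex.norm_real, Real.norm_eq_abs, abs_of_nonneg he]
            gcongr
            calc _ ≤ ‖shiftOp k‖ * ‖W u‖ := ContinuousLinearMap.le_opNorm _ _
              _ ≤ 1 * ‖W u‖ := by gcongr; exact norm_shiftOp_le k
              _ = _ := one_mul _
    refine h1.trans ?_
    rw [mul_right_comm]
    gcongr
    set x := |(k : ℝ)| with hx
    have hx0 : 0 ≤ x := abs_nonneg _
    have g1 : Real.exp (θ * x) - 1 ≤ θ * x * Real.exp (θ * x) := by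
      have := Real.add_one_le_exp (-(θ * x))
      have h2 : Real.exp (-(θ * x)) * Real.exp (θ * x) = 1 := by
        rw [← Real.exp_add]; simp
      nlinarith [Real.exp_pos (θ * x)]
    have g2 : β / 2 * x ≤ Real.exp (β / 2 * x) := by
      linarith [Real.add_one_le_exp (β / 2 * x)]
    calc _ ≤ θ * x * Real.exp (θ * x) := g1
      _ = 2 * θ / β * (β / 2 * x) * Real.exp (θ * x) := by field_simp
      _ ≤ 2 * θ / β * Real.exp (β / 2 * x) * Real.exp (β / 2 * x) := by gcongr
      _ = _ := by rw [mul_assoc, ← Real.exp_add]; ring_nf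
  have hcomm := D.norm_commutator_le hβ _ hw u _ hshift
  rw [← hC, ← hW] at hcomm
  have hWφ : ‖W φ‖ ≤ Real.exp (θ * m) * ‖φ‖ := by
    calc _ ≤ ‖(Real.exp (θ * m) : ℂ) • φ‖ := by
          refine SqSeq.norm_le_of_norm_apply_le _ _ fun j => ?_
          rw [hWn]
          change _ ≤ ‖(Real.exp (θ * m) : ℂ) * φ j‖
          rw [norm_mul, Complex.norm_real, Real.norm_eq_abs, Real.abs_exp]
          by_cases hj : m < |(j : ℝ)|
          · simp [hφ j hj]
          · gcongr
            exact (min_le_left _ _).trans (not_lt.1 hj)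
      _ = _ := by rw [norm_smul, Complex.norm_real, Real.norm_eq_abs, Real.abs_exp]
  have hWu : ‖W u‖ ≤ 2 * (Real.exp (θ * m) * ‖φ‖) := by
    have e : D.H (W u) - z • W u = (D.H (W u) - W (D.H u)) + W φ := by
      rw [← hu, map_sub, map_smul]; abel
    have h1 := (hz (W u)).trans ((congrArg norm e).le.trans (norm_add_le _ _))
    have h2 : 2 * θ / β * ‖W u‖ * C ≤ 1 / 2 * ‖W u‖ := by
      rw [mul_right_comm]; gcongr
    linarith
  have h3 := (SqSeq.norm_apply_le (W u) n).trans hWu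
  rw [hWn, min_self] at h3
  calc ‖u n‖ = Real.exp (θ * |(n : ℝ)|) * ‖u n‖ * Real.exp (-θ * |(n : ℝ)|) := by
        rw [mul_right_comm, ← Real.exp_add]; simp
    _ ≤ 2 * (Real.exp (θ * m) * ‖φ‖) * Real.exp (-θ * |(n : ℝ)|) := by gcongr
    _ = _ := by ring

/-! ### Green's functions of finite boxes -/

theorem restrict_mulVec (D : LongRangeData) (I : Finset ℤ) (z : ℂ) (v : SqSeq)
    (hv : ∀ n ∉ I, v n = 0) (j : I) :
    (D.restrict I z).mulVec (fun i : I => v i) j = (D.H v - z • v) j := by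
  have h : v = ∑ i : I, v i • (lp.single 2 (i : ℤ) (1 : ℂ) : SqSeq) := by
    rw [Finset.sum_coe_sort I (fun i => v i • (lp.single 2 i (1 : ℂ) : SqSeq))]
    ext m
    rw [lp.coeFn_sum, Finset.sum_apply]
    simp only [lp.coeFn_smul, Pi.smul_apply, lp.single_apply, Pi.single_apply, smul_eq_mul]
    by_cases hm : m ∈ I
    · simp [hm]
    · simp [hm, hv m hm]
  have h2 : D.H v - z • v = (D.H - z • ContinuousLinearMap.id ℂ SqSeq) v := rfl
  rw [h2]
  conv_rhs => rw [h, map_sum, lp.coeFn_sum, Finset.sum_apply]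
  simp only [Matrix.mulVec, dotProduct, restrict, Matrix.of_apply, map_smul, lp.coeFn_smul,
    Pi.smul_apply, smul_eq_mul]
  exact Finset.sum_congr rfl fun i _ => mul_comm _ _

/-- Extension of a vector on a finite set by zero. -/
noncomputable def extendZero (I : Finset ℤ) (v : I → ℂ) : SqSeq :=
  ∑ i : I, lp.single 2 (i : ℤ) (v i)

theorem extendZero_apply_coe (I : Finset ℤ) (v : I → ℂ) (i : I) : extendZero I v i = v i := by
  rw [extendZero, lp.coeFn_sum, Finset.sum_apply]
  simp only [lp.single_apply, Pi.single_apply]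
  rw [Finset.sum_eq_single i]
  · simp
  · intro b _ hb
    rw [if_neg]
    exact fun h => hb (Subtype.ext h.symm)
  · simp

theorem extendZero_apply_of_notMem (I : Finset ℤ) (v : I → ℂ) (n : ℤ) (hn : n ∉ I) :
    extendZero I v n = 0 := by
  rw [extendZero, lp.coeFn_sum, Finset.sum_apply]
  simp only [lp.single_apply, Pi.single_apply]
  refine Finset.sum_eq_zero fun b _ => if_neg ?_
  rintro rfl
  exact hn b.2

/-- A vector supported in `I` pairs only with the compression of `H - z` to `I`, so the argument of
`im_mul_norm_le` survives the restriction. It yields invertibility on every box and the a priori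
bound `1 / Im z` for Green's functions. -/
theorem im_mul_norm_extendZero_le (D : LongRangeData) (I : Finset ℤ) (z : ℂ) (v : I → ℂ) :
    |z.im| * ‖extendZero I v‖ ≤ ‖extendZero I ((D.restrict I z).mulVec v)‖ := by
  set u := extendZero I v with hu
  rcases eq_or_ne u 0 with h0 | h0
  · rw [h0]; simp
  have hin : inner ℂ u (D.H u - z • u) = inner ℂ u (extendZero I ((D.restrict I z).mulVec v)) := by
    rw [lp.inner_eq_tsum, lp.inner_eq_tsum]
    refine tsum_congr fun n => ?_
    by_cases hn : n ∈ I
    · have := D.restrict_mulVec I z u (extendZero_apply_of_notMem I v) ⟨n, hn⟩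
      simp only at this
      rw [← this]
      have h2 := extendZero_apply_coe I ((D.restrict I z).mulVec v) ⟨n, hn⟩
      simp only at h2
      rw [h2]
      congr 3
      funext i
      exact extendZero_apply_coe I v i
    · rw [hu, extendZero_apply_of_notMem I v n hn]; simp
  have h1 : (inner ℂ u (D.H u - z • u)).im = -(z.im * ‖u‖ ^ 2) := by
    rw [inner_sub_right, inner_smul_right, inner_self_eq_norm_sq_to_K, Complex.sub_im,
      D.inner_H_im]
    simp [← Complex.ofReal_pow]
  have h2 := (Complex.abs_im_le_norm _).trans
    (norm_inner_le_norm (𝕜 := ℂ) u (extendZero I ((D.restrict I z).mulVec v)))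
  rw [← hin, h1, abs_neg, abs_mul, abs_of_nonneg (sq_nonneg ‖u‖)] at h2
  have hu' : 0 < ‖u‖ := norm_pos_iff.2 h0
  nlinarith

theorem isUnit_restrict (D : LongRangeData) (I : Finset ℤ) {z : ℂ} (hz : 0 < z.im) :
    IsUnit (D.restrict I z) := by
  rw [← Matrix.mulVec_injective_iff_isUnit]
  rw [← Matrix.coe_mulVecLin, ← LinearMap.ker_eq_bot, LinearMap.ker_eq_bot']
  intro v hv
  have h := D.im_mul_norm_extendZero_le I z v
  rw [Matrix.mulVecLin_apply] at hv
  rw [hv] at h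
  have h0 : extendZero I 0 = 0 := by simp [extendZero]
  rw [h0, norm_zero, abs_of_pos hz] at h
  have h1 : extendZero I v = 0 := by
    rw [← norm_eq_zero]
    nlinarith [norm_nonneg (extendZero I v)]
  funext i
  rw [← extendZero_apply_coe I v i, h1]
  rfl

theorem norm_green_le (D : LongRangeData) (I : Finset ℤ) {z : ℂ} (hz : 0 < z.im) (i j : I) :
    ‖D.green I z i j‖ ≤ 1 / z.im := by
  set v : I → ℂ := (D.green I z).mulVec (Pi.single j 1) with hv
  have hvi : v i = D.green I z i j := by simp [hv]
  have hR : (D.restrict I z).mulVec v = Pi.single j 1 := by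
    rw [hv, Matrix.mulVec_mulVec, green, Matrix.mul_nonsing_inv, Matrix.one_mulVec]
    exact (Matrix.isUnit_iff_isUnit_det _).1 (D.isUnit_restrict I hz)
  have h := D.im_mul_norm_extendZero_le I z v
  have hs : extendZero I (Pi.single j 1) = lp.single 2 (j : ℤ) (1 : ℂ) := by
    rw [extendZero, Finset.sum_eq_single j]
    · simp
    · intro b _ hb
      simp [hb]
    · simp
  rw [hR, hs, lp.norm_single (E := fun _ : ℤ => ℂ) (p := 2) (by norm_num), abs_of_pos hz,
    norm_one] at h
  have h2 := SqSeq.norm_apply_le (extendZero I v) i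
  rw [extendZero_apply_coe, hvi] at h2
  rw [le_div_iff₀ hz]
  nlinarith

/-- The value at `j` of `H` applied to a state vanishing at distance less than `d` from `j`. -/
theorem norm_H_apply_le_of_far (D : LongRangeData) {β : ℝ} (hβ0 : 0 < β)
    (hβ : Summable (fun k : ℤ => ‖D.a k‖ * Real.exp (β * |(k : ℝ)|))) (u : SqSeq) (B : ℝ)
    (hB : ∀ n, ‖u n‖ ≤ B) (j : ℤ) (d : ℝ) (hd : 0 < d)
    (hu : ∀ n : ℤ, |(j : ℝ) - n| < d → u n = 0) :
    ‖D.H u j‖ ≤ B * Real.exp (-β * d) * ∑' k : ℤ, ‖D.a k‖ * Real.exp (β * |(k : ℝ)|) := by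
  have hB0 : 0 ≤ B := (norm_nonneg _).trans (hB 0)
  rw [H_apply, hu j (by simpa using hd), mul_zero, add_zero, ← tsum_mul_left]
  refine tsum_of_norm_bounded (hβ.mul_left _).hasSum fun k => ?_
  rw [norm_mul]
  by_cases hk : |(k : ℝ)| < d
  · rw [hu (j - k) (by push_cast; simpa using hk)]
    simp only [norm_zero, mul_zero]
    positivity
  -- Here `|k| ≥ d`, so the inserted factor `e^{β(|k| - d)}` is at least one.
  · calc ‖D.a k‖ * ‖u (j - k)‖ ≤ ‖D.a k‖ * (B * Real.exp (-β * d + β * |(k : ℝ)|)) := by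
          gcongr
          refine (hB _).trans (le_mul_of_one_le_right hB0 (Real.one_le_exp ?_))
          nlinarith [not_lt.1 hk]
      _ = _ := by rw [Real.exp_add]; ring

/-- A solution of `(H - z) u = φ` is small in the middle of a box on which `φ` vanishes and the
Green's function decays. -/
theorem norm_apply_le_of_green_le (D : LongRangeData) {β : ℝ} (hβ0 : 0 < β)
    (hβ : Summable (fun k : ℤ => ‖D.a k‖ * Real.exp (β * |(k : ℝ)|))) {z : ℂ} (hz : 0 < z.im)
    (u φ : SqSeq) (hu : D.H u - z • u = φ) (x y : ℤ) (κ : ℝ) (hκ : 0 ≤ κ)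
    (hφ : ∀ n ∈ Finset.Icc x y, φ n = 0)
    (hG : ∀ n n' : Finset.Icc x y, ((Finset.Icc x y).card : ℝ) / 20 ≤
      |(((n : ℤ) : ℝ) - ((n' : ℤ) : ℝ))| → ‖D.green (Finset.Icc x y) z n n'‖ ≤ κ)
    (hxy : x ≤ y) (i : ℤ)
    (hi : |2 * (i : ℝ) - (x + y)| ≤ ((Finset.Icc x y).card : ℝ) / 4) :
    ‖u i‖ ≤ (Finset.Icc x y).card * ‖u‖ * (∑' k : ℤ, ‖D.a k‖ * Real.exp (β * |(k : ℝ)|)) *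
      (κ + 1 / z.im * Real.exp (-β * (((Finset.Icc x y).card : ℝ) / 4))) := by
  set I := Finset.Icc x y with hI
  set C := ∑' k : ℤ, ‖D.a k‖ * Real.exp (β * |(k : ℝ)|) with hC
  have hC0 : 0 ≤ C := tsum_nonneg fun _ => by positivity
  have hcard : (I.card : ℝ) = y - x + 1 := by
    rw [hI, Int.card_Icc]
    have : (((y + 1 - x).toNat : ℤ) : ℝ) = ((y + 1 - x : ℤ) : ℝ) := by
      rw [Int.toNat_of_nonneg (by omega)]
    rw [← Int.cast_natCast, this]
    push_cast
    ring
  have hxy' : (x : ℝ) ≤ y := by exact_mod_cast hxy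
  rw [abs_le] at hi
  have hiI : i ∈ I := by
    rw [hI, Finset.mem_Icc]
    constructor
    · have : (x : ℝ) < i + 1 := by linarith
      have : x < i + 1 := by exact_mod_cast this
      omega
    · have : (i : ℝ) < y + 1 := by linarith
      have : i < y + 1 := by exact_mod_cast this
      omega
  set uI := extendZero I (fun j : I => u j) with huI
  have huI_in : ∀ n ∈ I, uI n = u n := fun n hn => extendZero_apply_coe I _ ⟨n, hn⟩
  have huI_out : ∀ n ∉ I, uI n = 0 := fun n hn => extendZero_apply_of_notMem I _ n hn
  set g := u - uI with hg
  have hg_in : ∀ n ∈ I, g n = 0 := fun n hn => by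
    rw [hg, lp.coeFn_sub, Pi.sub_apply, huI_in n hn, sub_self]
  have hg_le : ∀ n, ‖g n‖ ≤ ‖u‖ := fun n => by
    by_cases hn : n ∈ I
    · rw [hg_in n hn, norm_zero]; exact norm_nonneg _
    · rw [hg, lp.coeFn_sub, Pi.sub_apply, huI_out n hn, sub_zero]
      exact SqSeq.norm_apply_le u n
  -- On `I` both `φ` and `g` vanish, so `(H - z) u_I = φ - (H - z) g` reduces there to `-H g`.
  have hR : (D.restrict I z).mulVec (fun j : I => u j) = fun j : I => -(D.H g j) := by
    funext j
    have h1 := D.restrict_mulVec I z uI huI_out j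
    have h2 : (fun i : I => uI i) = fun i : I => u i := funext fun i => huI_in i i.2
    rw [h2] at h1
    rw [h1]
    have h3 : D.H uI - z • uI = φ - (D.H g - z • g) := by
      rw [← hu, hg, map_sub, smul_sub]; abel
    rw [h3]
    simp only [lp.coeFn_sub, lp.coeFn_smul, Pi.sub_apply, Pi.smul_apply, hφ j j.2,
      hg_in j j.2, smul_zero]
    ring
  have hsol : (fun j : I => u j) = (D.green I z).mulVec (fun j : I => -(D.H g j)) := by
    rw [← hR, Matrix.mulVec_mulVec, green, Matrix.nonsing_inv_mul, Matrix.one_mulVec]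
    exact (Matrix.isUnit_iff_isUnit_det _).1 (D.isUnit_restrict I hz)
  have hui : u i = ∑ j : I, D.green I z ⟨i, hiI⟩ j * -(D.H g j) := congrFun hsol ⟨i, hiI⟩
  rw [hui]
  have hterm : ∀ j : I, ‖D.green I z ⟨i, hiI⟩ j * -(D.H g j)‖ ≤
      ‖u‖ * C * (κ + 1 / z.im * Real.exp (-β * ((I.card : ℝ) / 4))) := by
    intro j
    rw [norm_mul, norm_neg]
    -- Far entries are bounded by `κ`. For near ones, `j` is within `|I|/8 + |I|/20` of the centre,
    -- hence at distance at least `|I|/4` from the complement of `I`, where `g` lives.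
    by_cases hj : (I.card : ℝ) / 20 ≤ |((i : ℝ) - ((j : ℤ) : ℝ))|
    · have h1 := hG ⟨i, hiI⟩ j hj
      have h2 := D.norm_H_apply_le_of_far hβ0 hβ g ‖u‖ hg_le j 1 one_pos (fun n hn => by
        have : |(j : ℤ) - n| < 1 := by exact_mod_cast hn
        have : n = j := by rw [Int.abs_lt_one_iff] at this; omega
        rw [this]; exact hg_in j j.2)
      rw [← hC] at h2
      calc _ ≤ κ * (‖u‖ * 1 * C) := by
            refine mul_le_mul h1 (h2.trans ?_) (norm_nonneg _) hκ
            gcongr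
            rw [Real.exp_le_one_iff]; linarith
        _ = ‖u‖ * C * κ := by ring
        _ ≤ _ := by
          gcongr
          have : 0 ≤ 1 / z.im * Real.exp (-β * ((I.card : ℝ) / 4)) := by positivity
          linarith
    · have h1 := D.norm_green_le I hz ⟨i, hiI⟩ j
      rw [not_le, abs_lt] at hj
      have h2 := D.norm_H_apply_le_of_far hβ0 hβ g ‖u‖ hg_le j ((I.card : ℝ) / 4)
        (by rw [hcard]; linarith) (fun n hn => by
          refine hg_in n ?_
          rw [abs_lt] at hn
          rw [hI, Finset.mem_Icc]
          constructor
          · have : (x : ℝ) < n + 1 := by linarith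
            have : x < n + 1 := by exact_mod_cast this
            omega
          · have : (n : ℝ) < y + 1 := by linarith
            have : n < y + 1 := by exact_mod_cast this
            omega)
      rw [← hC] at h2
      calc _ ≤ 1 / z.im * (‖u‖ * Real.exp (-β * ((I.card : ℝ) / 4)) * C) := by gcongr
        _ = ‖u‖ * C * (1 / z.im * Real.exp (-β * ((I.card : ℝ) / 4))) := by ring
        _ ≤ _ := by gcongr; linarith
  refine (norm_sum_le _ _).trans ((Finset.sum_le_sum fun j _ => hterm j).trans (le_of_eq ?_))
  rw [Finset.sum_const, Finset.card_univ, Fintype.card_coe, nsmul_eq_mul]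
  ring

/-- A solution of `(H - z) u = φ` which is small near the edge of a half-line `S` on which `φ`
vanishes is small on `S`. -/
theorem norm_apply_le_of_cut (D : LongRangeData) {β : ℝ} (hβ0 : 0 < β)
    (hβ : Summable (fun k : ℤ => ‖D.a k‖ * Real.exp (β * |(k : ℝ)|))) {z : ℂ} (hz : 0 < z.im)
    (u φ : SqSeq) (hu : D.H u - z • u = φ) (S : Set ℤ) (c : ℤ)
    -- Any jump between `S` and its complement passes over the cut `c / 2`, so both ends are within
    -- the jump length of it. Doubling avoids half-integers.
    (hS : ∀ n ∈ S, ∀ m ∉ S, |2 * m - c| ≤ 2 * |n - m| ∧ |2 * n - c| ≤ 2 * |n - m|)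
    (hφ : ∀ n ∈ S, φ n = 0) (q η : ℝ) (hη0 : 0 ≤ η)
    (hη : ∀ l : ℤ, |2 * (l : ℝ) - c| ≤ 2 * q → ‖u l‖ ≤ η) (n : ℤ) (hn : n ∈ S) :
    ‖u n‖ ≤ 1 / z.im * ((3 * η / β + ‖u‖ * Real.exp (-β * q)) *
      ∑' k : ℤ, ‖D.a k‖ * Real.exp (β * |(k : ℝ)|)) := by
  classical
  set w : ℤ → ℝ := fun j => if j ∈ S then 1 else 0 with hw
  have hwb : ∃ C : ℝ, ∀ j : ℤ, |w j| ≤ C :=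
    ⟨1, fun j => by simp only [hw]; split_ifs <;> simp⟩
  set W := potentialOp w hwb with hW
  have hWS : ∀ (v : SqSeq) (j : ℤ), j ∈ S → W v j = v j := fun v j hj => by
    rw [hW, potentialOp_apply]; simp [hw, hj]
  have hWφ : W φ = 0 := by
    ext j
    rw [hW, potentialOp_apply]
    by_cases hj : j ∈ S
    · simp [hφ j hj]
    · simp [hw, hj]
  have hshift : ∀ k : ℤ, ‖shiftOp k (W u) - W (shiftOp k u)‖
      ≤ (3 * η / β + ‖u‖ * Real.exp (-β * q)) * Real.exp (β * |(k : ℝ)|) := by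
    intro k
    set f := shiftOp k (W u) - W (shiftOp k u) with hf
    have hfn : ∀ j, f j = ((w (j - k) - w j : ℝ) : ℂ) * u (j - k) := fun j => by
      rw [hf, lp.coeFn_sub, Pi.sub_apply, shiftOp_apply, hW, potentialOp_apply,
        potentialOp_apply, shiftOp_apply]
      push_cast
      ring
    have hw1 : ∀ j, |w (j - k) - w j| ≤ 1 := fun j => by
      simp only [hw]; split_ifs <;> simp
    have hfle : ∀ j, ‖f j‖ ≤ ‖u (j - k)‖ := fun j => by
      rw [hfn, norm_mul, Complex.norm_real, Real.norm_eq_abs]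
      exact mul_le_of_le_one_left (norm_nonneg _) (hw1 j)
    have hfne : ∀ j, f j ≠ 0 → |2 * (j - k) - c| ≤ 2 * |k| := fun j hj => by
      have : w (j - k) ≠ w j := fun h => hj (by rw [hfn, h]; simp)
      by_cases h1 : j - k ∈ S <;> by_cases h2 : j ∈ S
      · simp [hw, h1, h2] at this
      · have := (hS _ h1 _ h2).2
        simpa [abs_neg] using this
      · have := (hS _ h2 _ h1).1
        simpa using this
      · simp [hw, h1, h2] at this
    have he : 0 ≤ Real.exp (β * |(k : ℝ)|) := (Real.exp_pos _).le
    -- A short translation sees `u` only within `|k| ≤ q` of the cut, where it is at most `η`. A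
    -- long one gets the trivial bound `‖u‖`, paid for by `e^{β|k|} ≥ e^{βq}`.
    by_cases hk : |(k : ℝ)| ≤ q
    · have h3 : ‖f‖ ≤ 3 * |(k : ℝ)| * η := by
        rcases eq_or_ne k 0 with rfl | hk0
        · have : f = 0 := by
            ext j
            rw [hfn]; simp
          rw [this]; simp
        -- This interval has `2|k| + 1` points, at most `3|k|` because `k ≠ 0`.
        · set s := Finset.Icc (c / 2 - |k| + k) (c / 2 + |k| + k) with hs
          have hk1 : 1 ≤ |k| := Int.one_le_abs hk0
          have hsup : ∀ j ∉ s, f j = 0 := fun j hj => by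
            by_contra h
            have h4 := hfne j h
            rw [abs_le] at h4
            apply hj
            rw [hs, Finset.mem_Icc]
            omega
          have hcard : ((s.card : ℕ) : ℝ) ≤ 3 * |(k : ℝ)| := by
            have : ((s.card : ℕ) : ℤ) ≤ 3 * |k| := by
              rw [hs, Int.card_Icc]; omega
            exact_mod_cast this
          calc ‖f‖ ≤ ∑ j ∈ s, ‖f j‖ := SqSeq.norm_le_sum_of_support f s hsup
            _ ≤ ∑ j ∈ s, η := by
              refine Finset.sum_le_sum fun j _ => ?_
              by_cases hj : f j = 0
              · rw [hj, norm_zero]; exact hη0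
              · refine (hfle j).trans (hη _ ?_)
                have h4 : |2 * ((j - k : ℤ) : ℝ) - c| ≤ 2 * |(k : ℝ)| := by
                  exact_mod_cast hfne j hj
                linarith
            _ = s.card * η := by rw [Finset.sum_const, nsmul_eq_mul]
            _ ≤ _ := by gcongr
      have h4 : |(k : ℝ)| ≤ Real.exp (β * |(k : ℝ)|) / β := by
        rw [le_div_iff₀ hβ0]
        linarith [Real.add_one_le_exp (β * |(k : ℝ)|)]
      calc ‖f‖ ≤ 3 * |(k : ℝ)| * η := h3
        _ ≤ 3 * (Real.exp (β * |(k : ℝ)|) / β) * η := by gcongr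
        _ = 3 * η / β * Real.exp (β * |(k : ℝ)|) := by ring
        _ ≤ _ := by
          gcongr
          have : 0 ≤ ‖u‖ * Real.exp (-β * q) := by positivity
          linarith
    · have h3 : ‖f‖ ≤ ‖u‖ := by
        calc ‖f‖ ≤ ‖shiftOp k u‖ := SqSeq.norm_le_of_norm_apply_le _ _ hfle
          _ ≤ ‖shiftOp k‖ * ‖u‖ := ContinuousLinearMap.le_opNorm _ _
          _ ≤ 1 * ‖u‖ := by gcongr; exact norm_shiftOp_le k
          _ = _ := one_mul _
      calc ‖f‖ ≤ ‖u‖ * 1 := by rw [mul_one]; exact h3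
        _ ≤ ‖u‖ * Real.exp (-β * q + β * |(k : ℝ)|) := by
          gcongr
          refine Real.one_le_exp ?_
          nlinarith [not_le.1 hk]
        _ = ‖u‖ * Real.exp (-β * q) * Real.exp (β * |(k : ℝ)|) := by rw [Real.exp_add]; ring
        _ ≤ _ := by
          gcongr
          have : 0 ≤ 3 * η / β := by positivity
          linarith
  have hcomm := D.norm_commutator_le hβ w hwb u _ hshift
  rw [← hW] at hcomm
  have e : D.H (W u) - z • W u = D.H (W u) - W (D.H u) := by
    have : W (D.H u - z • u) = 0 := by rw [hu, hWφ]
    rw [map_sub, map_smul, sub_eq_zero] at this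
    rw [this]
  have h1 := D.im_mul_norm_le z (W u)
  rw [e, abs_of_pos hz] at h1
  have h2 := SqSeq.norm_apply_le (W u) n
  rw [hWS u n hn] at h2
  rw [one_div, ← div_eq_inv_mul, le_div_iff₀ hz]
  nlinarith

/-- The half-line is cut at the centre of the box. The three factors `1 / Im z` come from `‖u‖ ≤ ‖φ‖
/ Im z`, from the near entries of the Green's function, and from inverting `H - z` on the truncated
solution. -/
theorem norm_apply_le_of_goodBox (D : LongRangeData) :
    ∃ b C : ℝ, 0 < b ∧ 0 ≤ C ∧ ∀ (δ : ℝ) (N : ℕ) (z : ℂ) (x y : ℤ) (u φ : SqSeq) (S : Set ℤ),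
      1 ≤ N → 0 < z.im → z.im ≤ 1 → D.GoodBox δ z N (Finset.Icc x y) → D.H u - z • u = φ →
      (∀ n ∈ S, ∀ m ∉ S, |2 * m - (x + y)| ≤ 2 * |n - m| ∧ |2 * n - (x + y)| ≤ 2 * |n - m|) →
      (∀ n ∈ S, φ n = 0) → (∀ n ∈ Finset.Icc x y, φ n = 0) → ∀ n ∈ S,
      ‖u n‖ ≤ C * ‖φ‖ * (1 / z.im) ^ 3 * ((Finset.Icc x y).card *
        (Real.exp (-((Finset.Icc x y).card : ℝ) ^ δ) +
          Real.exp (-b * (Finset.Icc x y).card))) := by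
  obtain ⟨β, hβ0, hβ⟩ := D.exists_exp_moment
  set C := ∑' k : ℤ, ‖D.a k‖ * Real.exp (β * |(k : ℝ)|) with hC
  have hC0 : 0 ≤ C := tsum_nonneg fun _ => by positivity
  -- The rate `β / 8` comes from `q = |I| / 8`, the half-width of the middle part where `u` is
  -- controlled.
  refine ⟨β / 8, C * (3 * C / β + 1), by positivity, by positivity, ?_⟩
  intro δ N z x y u φ S hN hz hz1 hI hu hS hφS hφI n hn
  obtain ⟨hI1, hI2⟩ := hI
  set X : ℝ := ((Finset.Icc x y).card : ℝ) with hX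
  have hX0 : 0 < X := lt_of_lt_of_le (Real.rpow_pos_of_pos (by exact_mod_cast hN) δ) hI1
  have hcard : 0 < (Finset.Icc x y).card := Nat.cast_pos.1 hX0
  have hX1 : 1 ≤ X := Nat.one_le_cast.2 hcard
  have hxy : x ≤ y := by rwa [Finset.card_pos, Finset.nonempty_Icc] at hcard
  set τ := 1 / z.im with hτ
  have hτ1 : 1 ≤ τ := by rw [hτ, le_div_iff₀ hz]; linarith
  set κ := Real.exp (-X ^ δ) with hκ
  set F := κ + Real.exp (-(β / 8) * X) with hF
  have hF0 : 0 ≤ F := by positivity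
  have hu' : ‖u‖ ≤ τ * ‖φ‖ := by
    have := D.im_mul_norm_le z u
    rw [hu, abs_of_pos hz] at this
    rw [hτ, one_div, ← div_eq_inv_mul, le_div_iff₀ hz]
    linarith
  set η := X * (τ * ‖φ‖) * C * (τ * F) with hη
  have hη0 : 0 ≤ η := by positivity
  have hmid : ∀ l : ℤ, |2 * (l : ℝ) - ((x + y : ℤ) : ℝ)| ≤ 2 * (X / 8) → ‖u l‖ ≤ η := by
    intro l hl
    have := D.norm_apply_le_of_green_le hβ0 hβ hz u φ hu x y κ (Real.exp_pos _).le hφI hI2 hxy l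
      (by push_cast at hl; linarith)
    refine this.trans ?_
    rw [hη]
    have h5 : Real.exp (-β * (X / 4)) ≤ Real.exp (-(β / 8) * X) :=
      Real.exp_le_exp.2 (by nlinarith)
    have h6 : κ + τ * Real.exp (-β * (X / 4)) ≤ τ * F := by
      rw [hF, mul_add]
      exact add_le_add (le_mul_of_one_le_left (Real.exp_pos _).le hτ1) (by gcongr)
    gcongr
  have h1 := D.norm_apply_le_of_cut hβ0 hβ hz u φ hu S (x + y) hS hφS (X / 8) η hη0 hmid n hn
  have h2 : ‖u‖ * Real.exp (-β * (X / 8)) ≤ τ ^ 2 * ‖φ‖ * X * F := by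
    have e1 : Real.exp (-β * (X / 8)) ≤ F := by
      rw [hF]
      have : -β * (X / 8) = -(β / 8) * X := by ring
      rw [this]
      linarith [Real.exp_pos (-X ^ δ)]
    calc _ ≤ τ * ‖φ‖ * F := by gcongr
      _ = τ * 1 * ‖φ‖ * 1 * F := by ring
      _ ≤ τ * τ * ‖φ‖ * X * F := by gcongr
      _ = _ := by ring
  calc ‖u n‖ ≤ τ * ((3 * η / β + ‖u‖ * Real.exp (-β * (X / 8))) * C) := h1
    _ ≤ τ * ((3 * η / β + τ ^ 2 * ‖φ‖ * X * F) * C) := by gcongr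
    _ = _ := by rw [hη]; ring

end LongRangeData

/-! ### Stretched exponentials against powers. -/

theorem Real.exists_exp_neg_mul_rpow_le {b s : ℝ} (hb : 0 < b) (hs : 0 < s) (r : ℝ) :
    ∃ C : ℝ, 0 ≤ C ∧ ∀ x : ℝ, 1 ≤ x → Real.exp (-b * x ^ s) ≤ C * x ^ (-r) := by
  obtain ⟨k, hk⟩ := exists_nat_ge (r / s)
  refine ⟨k.factorial / b ^ k, by positivity, fun x hx => ?_⟩
  have hx0 : 0 < x := by linarith
  have h1 := Real.pow_div_factorial_le_exp (b * x ^ s) (by positivity) k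
  have h2 : x ^ r ≤ (x ^ s) ^ k := by
    rw [← Real.rpow_mul_natCast hx0.le]
    refine Real.rpow_le_rpow_of_exponent_le hx ?_
    rw [div_le_iff₀ hs] at hk
    linarith
  have h3 : b ^ k / k.factorial * x ^ r ≤ Real.exp (b * x ^ s) := by
    refine le_trans ?_ h1
    rw [mul_pow, mul_div_right_comm]
    gcongr
  rw [neg_mul, Real.exp_neg, Real.rpow_neg hx0.le]
  rw [show (k.factorial : ℝ) / b ^ k * (x ^ r)⁻¹ = (b ^ k / k.factorial * x ^ r)⁻¹ by
    rw [mul_inv, inv_div]]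
  exact inv_anti₀ (by positivity) h3

theorem Real.exists_mul_exp_add_exp_le {b s : ℝ} (hb : 0 < b) (hs : 0 < s) (r : ℝ) :
    ∃ C : ℝ, 0 ≤ C ∧ ∀ x : ℝ, 1 ≤ x →
      x * (Real.exp (-x ^ s) + Real.exp (-b * x)) ≤ C * x ^ (-r) := by
  obtain ⟨C₁, h₁, H₁⟩ := Real.exists_exp_neg_mul_rpow_le one_pos hs (r + 1)
  obtain ⟨C₂, h₂, H₂⟩ := Real.exists_exp_neg_mul_rpow_le hb one_pos (r + 1)
  refine ⟨C₁ + C₂, by positivity, fun x hx => ?_⟩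
  have e1 := H₁ x hx
  have e2 := H₂ x hx
  rw [neg_one_mul] at e1
  rw [Real.rpow_one] at e2
  have hx0 : 0 < x := by linarith
  calc _ ≤ x * (C₁ * x ^ (-(r + 1)) + C₂ * x ^ (-(r + 1))) := by gcongr
    _ = (C₁ + C₂) * (x ^ (-(r + 1)) * x) := by ring
    _ = _ := by
      rw [← Real.rpow_add_one hx0.ne']
      ring_nf

/-! ### Decay of the resolvent. -/

namespace LongRangeData

/-- Arbitrarily fast polynomial decay of the resolvent near the spectrum. -/
theorem exists_resolvent_decay (D : LongRangeData) {K δ : ℝ} (hδ : 0 < δ) (N₀ : ℕ)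
    (hG : ∀ E ε : ℝ, |E| ≤ K → 0 < ε → ε ≤ δ → ∀ N : ℕ, N₀ < N →
      (∃ x y : ℤ, (N : ℝ) / 4 ≤ (x : ℝ) ∧ (y : ℝ) ≤ (N : ℝ) / 2 ∧
        D.GoodBox δ ((E : ℂ) + Complex.I * (ε : ℂ)) N (Finset.Icc x y)) ∧
      (∃ x y : ℤ, -((N : ℝ) / 2) ≤ (x : ℝ) ∧ (y : ℝ) ≤ -((N : ℝ) / 4) ∧
        D.GoodBox δ ((E : ℂ) + Complex.I * (ε : ℂ)) N (Finset.Icc x y)))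
    (φ : SqSeq) (m : ℕ) (hφ : ∀ n : ℤ, (m : ℝ) < |(n : ℝ)| → φ n = 0) (M : ℕ) :
    ∃ (C : ℝ) (n₁ : ℕ), 0 ≤ C ∧ ∀ z : ℂ, |z.re| ≤ K → 0 < z.im → z.im ≤ δ → z.im ≤ 1 →
      ∀ u : SqSeq, D.H u - z • u = φ → ∀ n : ℤ, n₁ ≤ n.natAbs →
        ‖u n‖ ≤ C * (1 / z.im) ^ 3 * (|(n : ℝ)| ^ M)⁻¹ := by
  obtain ⟨b, C₁, hb, hC₁, H⟩ := D.norm_apply_le_of_goodBox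
  -- The exponent is `M / δ` because the box is only known to satisfy `|I| ≥ N^δ`.
  obtain ⟨C₂, hC₂, H₂⟩ := Real.exists_mul_exp_add_exp_le hb hδ (M / δ)
  refine ⟨C₁ * ‖φ‖ * C₂, N₀ + 4 * m + 1, by positivity, ?_⟩
  intro z hzK hz0 hzδ hz1 u hu n hn
  -- At the scale `N = |n| > 4m` the box starts beyond the support of `φ`, and it ends at `|n| / 2`
  -- at the latest, so `n` lies on the far side of its centre.
  set N := n.natAbs with hN
  have hNabs : (N : ℝ) = |(n : ℝ)| := by rw [hN, Nat.cast_natAbs, Int.cast_abs]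
  have hN0 : (0 : ℝ) < N := by exact_mod_cast (by omega : 0 < N)
  have hNm : (4 * m : ℝ) < N := by exact_mod_cast (by omega : 4 * m < N)
  have hzz : (z.re : ℂ) + Complex.I * (z.im : ℂ) = z := by
    rw [mul_comm]; exact Complex.re_add_im z
  obtain ⟨⟨x, y, hx, hy, hB⟩, ⟨x', y', hx', hy', hB'⟩⟩ :=
    hG z.re z.im hzK hz0 hzδ N (by omega)
  rw [hzz] at hB hB'
  have key : ∀ X : ℕ, (N : ℝ) ^ δ ≤ X → C₁ * ‖φ‖ * (1 / z.im) ^ 3 *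
      (X * (Real.exp (-(X : ℝ) ^ δ) + Real.exp (-b * X))) ≤
      C₁ * ‖φ‖ * C₂ * (1 / z.im) ^ 3 * (|(n : ℝ)| ^ M)⁻¹ := by
    intro X hX
    have hX0 : (0 : ℝ) < X := lt_of_lt_of_le (Real.rpow_pos_of_pos hN0 δ) hX
    have hX1 : (1 : ℝ) ≤ X := by
      have : 0 < X := by exact_mod_cast hX0
      exact_mod_cast this
    have h1 := H₂ X hX1
    have h2 : (X : ℝ) ^ (-(M / δ)) ≤ (|(n : ℝ)| ^ M)⁻¹ := by
      rw [← hNabs, Real.rpow_neg hX0.le]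
      refine inv_anti₀ (by positivity) ?_
      calc (N : ℝ) ^ M = ((N : ℝ) ^ δ) ^ (M / δ) := by
            rw [← Real.rpow_mul hN0.le, mul_div_cancel₀ _ hδ.ne', Real.rpow_natCast]
        _ ≤ _ := Real.rpow_le_rpow (by positivity) hX (by positivity)
    calc _ ≤ C₁ * ‖φ‖ * (1 / z.im) ^ 3 * (C₂ * (|(n : ℝ)| ^ M)⁻¹) := by
          exact mul_le_mul_of_nonneg_left (h1.trans (by gcongr)) (by positivity)
      _ = _ := by ring
  have hcpos : ∀ x y : ℤ, D.GoodBox δ z N (Finset.Icc x y) → x ≤ y := by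
    intro x y h
    have h0 : (0 : ℝ) < (Finset.Icc x y).card :=
      lt_of_lt_of_le (Real.rpow_pos_of_pos hN0 δ) h.1
    have : 0 < (Finset.Icc x y).card := by exact_mod_cast h0
    rwa [Finset.card_pos, Finset.nonempty_Icc] at this
  rcases le_or_gt 0 n with hn0 | hn0
  · have hxy := hcpos x y hB
    have hnN : (n : ℝ) = N := by rw [hNabs, abs_of_nonneg (by exact_mod_cast hn0)]
    have hxm : (m : ℝ) < x := by linarith
    have hyn : 2 * (y : ℝ) ≤ n := by linarith
    have hxm' : (m : ℤ) < x := by exact_mod_cast hxm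
    have hyn' : 2 * y ≤ n := by exact_mod_cast hyn
    have hφ' : ∀ j : ℤ, (m : ℤ) < j → φ j = 0 := fun j hj => by
      refine hφ j ?_
      have : (m : ℤ) < |j| := lt_of_lt_of_le hj (le_abs_self j)
      exact_mod_cast this
    refine (H δ N z x y u φ {j | x + y < 2 * j} (by omega) hz0 hz1 hB hu ?_ ?_ ?_ n ?_).trans
      (key _ hB.1)
    · intro i hi j hj
      simp only [Set.mem_ofPred_eq, not_lt] at hi hj
      have h1 := le_abs_self (i - j)
      have h2 := neg_le_abs (i - j)
      rw [abs_le, abs_le]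
      omega
    · intro j hj
      simp only [Set.mem_ofPred_eq] at hj
      exact hφ' j (by omega)
    · intro j hj
      rw [Finset.mem_Icc] at hj
      exact hφ' j (by omega)
    · simp only [Set.mem_ofPred_eq]
      omega
  · have hxy := hcpos x' y' hB'
    have hnN : -(n : ℝ) = N := by rw [hNabs, abs_of_neg (by exact_mod_cast hn0)]
    have hxm : (y' : ℝ) < -m := by linarith
    have hyn : (n : ℝ) ≤ 2 * x' := by linarith
    have hxm' : y' < -(m : ℤ) := by exact_mod_cast hxm
    have hyn' : n ≤ 2 * x' := by exact_mod_cast hyn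
    have hφ' : ∀ j : ℤ, j < -(m : ℤ) → φ j = 0 := fun j hj => by
      refine hφ j ?_
      have : (m : ℤ) < |j| := lt_of_lt_of_le (by omega) (neg_le_abs j)
      exact_mod_cast this
    refine (H δ N z x' y' u φ {j | 2 * j < x' + y'} (by omega) hz0 hz1 hB' hu ?_ ?_ ?_ n ?_).trans
      (key _ hB'.1)
    · intro i hi j hj
      simp only [Set.mem_ofPred_eq, not_lt] at hi hj
      have h1 := le_abs_self (i - j)
      have h2 := neg_le_abs (i - j)
      rw [abs_le, abs_le]
      omega
    · intro j hj
      simp only [Set.mem_ofPred_eq] at hj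
      exact hφ' j (by omega)
    · intro j hj
      rw [Finset.mem_Icc] at hj
      exact hφ' j (by omega)
    · simp only [Set.mem_ofPred_eq]
      omega

end LongRangeData

/-! ### From the resolvent to the evolution. -/

/-- The holomorphic functional calculus of the exponential, along a circle around a point `c` with
radius larger than `‖T - c‖`. -/
theorem circleIntegral_exp_smul_resolvent {A : Type*} [NormedRing A] [NormedAlgebra ℂ A]
    [NormOneClass A] [CompleteSpace A] (T : A) (c s : ℂ) {r : ℝ}
    (hr : ‖T - algebraMap ℂ A c‖ < r) :
    (∮ z in C(c, r), Complex.exp (s * z) • resolvent T z) =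
      (2 * (Real.pi : ℂ) * Complex.I) • NormedSpace.exp (s • T) := by
  set B := T - algebraMap ℂ A c with hB
  have hr0 : 0 < r := (norm_nonneg _).trans_lt hr
  -- The resolvent is expanded in a Neumann series about `c` and integrated termwise. Cauchy's
  -- formula for the derivatives of `e^{sz}` at `c` then produces the series of `e^{sc} exp (s B)`.
  have hres : ∀ z ∈ Metric.sphere c r,
      HasSum (fun n : ℕ => (1 / (z - c) ^ (n + 1)) • B ^ n) (resolvent T z) := by
    intro z hz
    have hzc : ‖z - c‖ = r := by simpa [dist_eq_norm] using hz
    have hz0 : z - c ≠ 0 := by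
      rw [← norm_pos_iff, hzc]; exact hr0
    have hlt : ‖(z - c)⁻¹ • B‖ < 1 := by
      rw [norm_smul, norm_inv, hzc, inv_mul_lt_iff₀ hr0, mul_one]
      exact hr
    have hsum := summable_geometric_of_norm_lt_one hlt
    have hinv : resolvent T z = (z - c)⁻¹ • ∑' n : ℕ, ((z - c)⁻¹ • B) ^ n := by
      have hu : algebraMap ℂ A z - T = (z - c) • (1 - (z - c)⁻¹ • B) := by
        rw [smul_sub, smul_smul, mul_inv_cancel₀ hz0, one_smul, hB, Algebra.algebraMap_eq_smul_one,
          Algebra.algebraMap_eq_smul_one, sub_smul]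
        abel
      have e1 := mul_neg_geom_series _ hlt
      have e2 := geom_series_mul_neg _ hlt
      set Sg := ∑' n : ℕ, ((z - c)⁻¹ • B) ^ n
      rw [resolvent, hu]
      exact Ring.inverse_unit ⟨(z - c) • (1 - (z - c)⁻¹ • B), (z - c)⁻¹ • Sg,
        by rw [smul_mul_smul_comm, mul_inv_cancel₀ hz0, one_smul, e1],
        by rw [smul_mul_smul_comm, inv_mul_cancel₀ hz0, one_smul, e2]⟩
    rw [hinv]
    convert hsum.hasSum.const_smul ((z - c)⁻¹) using 2 with n
    rw [smul_pow, smul_smul, pow_succ, one_div, mul_inv, inv_pow, mul_comm]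
  have hint : HasSum (fun n : ℕ => ∮ z in C(c, r),
      ((1 / (z - c) ^ (n + 1)) • Complex.exp (s * z)) • B ^ n)
      (∮ z in C(c, r), Complex.exp (s * z) • resolvent T z) := by
    simp only [circleIntegral]
    refine intervalIntegral.hasSum_integral_of_dominated_convergence
      (fun n _ => Real.exp (‖s‖ * (‖c‖ + r)) * (‖B‖ / r) ^ n) ?_ ?_ ?_ ?_ ?_
    · intro n
      refine Continuous.aestronglyMeasurable ?_
      have h0 : ∀ θ, (circleMap c r θ - c) ^ (n + 1) ≠ 0 := fun θ => by
        rw [circleMap_sub_center]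
        exact pow_ne_zero _ (circleMap_ne_center (c := 0) hr0.ne')
      simp only [deriv_circleMap]
      have hc0 : Continuous (circleMap 0 r) := continuous_circleMap 0 r
      have hc1 : Continuous (circleMap c r) := continuous_circleMap c r
      exact (hc0.mul continuous_const).smul (((continuous_const.div
        ((hc1.sub continuous_const).pow _) h0).smul
        (Complex.continuous_exp.comp (continuous_const.mul hc1))).smul continuous_const)
    · intro n
      refine Filter.Eventually.of_forall fun θ _ => ?_
      have hn : ‖circleMap c r θ - c‖ = r := by
        rw [circleMap_sub_center, norm_circleMap_zero, abs_of_pos hr0]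
      have hn' : ‖circleMap c r θ‖ ≤ ‖c‖ + r := by
        have := norm_add_le (circleMap c r θ - c) c
        rw [sub_add_cancel, hn] at this
        linarith
      rw [deriv_circleMap, norm_smul, norm_smul, norm_smul, norm_mul, norm_circleMap_zero,
        Complex.norm_I, mul_one, norm_div, norm_one, norm_pow, hn, abs_of_pos hr0]
      have h1 : ‖Complex.exp (s * circleMap c r θ)‖ ≤ Real.exp (‖s‖ * (‖c‖ + r)) := by
        refine (Complex.norm_exp_le_exp_norm _).trans ?_
        rw [Real.exp_le_exp, norm_mul]
        gcongr
      calc r * (1 / r ^ (n + 1) * ‖Complex.exp (s * circleMap c r θ)‖ * ‖B ^ n‖)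
          ≤ r * (1 / r ^ (n + 1) * Real.exp (‖s‖ * (‖c‖ + r)) * ‖B‖ ^ n) := by
            gcongr
            exact norm_pow_le B n
        _ = _ := by rw [div_pow]; field_simp; ring
    · refine Filter.Eventually.of_forall fun θ _ => ?_
      refine Summable.mul_left _ (summable_geometric_of_lt_one (by positivity) ?_)
      rwa [div_lt_one hr0]
    · simp
    · refine Filter.Eventually.of_forall fun θ _ => ?_
      have h1 := (hres _ (circleMap_mem_sphere c hr0.le θ)).const_smul
        (Complex.exp (s * circleMap c r θ))
      have h2 := h1.const_smul (deriv (circleMap c r) θ)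
      refine Eq.mp (congrArg (fun f => HasSum f _) (funext fun n => ?_)) h2
      rw [smul_smul (Complex.exp _), smul_eq_mul, mul_comm (Complex.exp _)]
  have hterm : ∀ n : ℕ, (∮ z in C(c, r), ((1 / (z - c) ^ (n + 1)) • Complex.exp (s * z)) • B ^ n) =
      (2 * (Real.pi : ℂ) * Complex.I * Complex.exp (s * c)) •
        (((n.factorial : ℂ)⁻¹) • (s • B) ^ n) := by
    intro n
    have hd : DifferentiableOn ℂ (fun z => Complex.exp (s * z)) (Metric.closedBall c r) :=
      (Complex.differentiable_exp.comp (differentiable_id.const_mul s)).differentiableOn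
    have h1 := hd.circleIntegral_one_div_sub_center_pow_smul hr0 n
    rw [iteratedDeriv_cexp_const_mul] at h1
    rw [circleIntegral.integral_smul_const, h1, smul_pow, smul_smul, smul_smul, smul_eq_mul]
    congr 1
    ring
  have hexp := ((NormedSpace.exp_series_hasSum_exp' (𝕂 := ℂ) (s • B)).const_smul
    (2 * (Real.pi : ℂ) * Complex.I * Complex.exp (s * c)))
  simp only [hterm] at hint
  rw [hint.unique hexp, mul_smul]
  congr 1
  have hT : s • T = algebraMap ℂ A (s * c) + s • B := by
    rw [hB, smul_sub, map_mul, ← Algebra.smul_def]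
    abel
  have hcomm : Commute (algebraMap ℂ A (s * c)) (s • B) := Algebra.commute_algebraMap_left _ _
  rw [hT]
  let := NormedAlgebra.restrictScalars ℚ ℂ A
  rw [NormedSpace.exp_add_of_commute hcomm, ← NormedSpace.algebraMap_exp_comm (𝕂 := ℂ),
    Algebra.smul_def, Complex.exp_eq_exp_ℂ]

namespace LongRangeData

/-- The cross term vanishes because `⟨H u, u⟩` is real, so `‖(H + iY) u‖² = ‖H u‖² + Y² ‖u‖²`. Thus
the circle about `-iY` need only be slightly larger than `Y` to enclose the spectrum. -/
theorem norm_H_add_le (D : LongRangeData) (Y : ℝ) :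
    ‖D.H - algebraMap ℂ (SqSeq →L[ℂ] SqSeq) (-(Complex.I * Y))‖ ≤
      Real.sqrt (Y ^ 2 + ‖D.H‖ ^ 2) := by
  refine ContinuousLinearMap.opNorm_le_bound _ (Real.sqrt_nonneg _) fun u => ?_
  have h1 : (D.H - algebraMap ℂ (SqSeq →L[ℂ] SqSeq) (-(Complex.I * Y))) u =
      D.H u - (-(Complex.I * Y)) • u := rfl
  rw [h1]
  refine le_of_sq_le_sq ?_ (by positivity)
  have h2 : RCLike.re (inner ℂ (D.H u) ((-(Complex.I * Y)) • u)) = 0 := by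
    have h3 : (inner ℂ (D.H u) u).im = 0 := by
      rw [← inner_conj_symm, Complex.conj_im, D.inner_H_im, neg_zero]
    rw [inner_smul_right]
    simp [h3]
  rw [@norm_sub_sq ℂ, h2, mul_pow, Real.sq_sqrt (by positivity), norm_smul, norm_neg, norm_mul,
    Complex.norm_I, one_mul, Complex.norm_real, Real.norm_eq_abs, mul_pow, sq_abs]
  have h4 := D.H.le_opNorm u
  have h5 : ‖D.H u‖ ^ 2 ≤ ‖D.H‖ ^ 2 * ‖u‖ ^ 2 := by
    rw [← mul_pow]; gcongr
  linarith

/-- If the solutions of `(H - z) u = φ` are small at the site `n` for all `z` on a large circle,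
so is `e^{-itH} φ`. -/
theorem norm_evolve_apply_le_of_circle (D : LongRangeData) (φ : SqSeq) (t : ℝ) (n : ℤ)
    {Y r : ℝ} (hr : Real.sqrt (Y ^ 2 + ‖D.H‖ ^ 2) < r) (B h : ℝ) (ht : 0 ≤ t)
    (hh : ∀ z ∈ Metric.sphere (-(Complex.I * Y)) r, z.im ≤ h)
    (hres : ∀ z ∈ Metric.sphere (-(Complex.I * Y)) r, ∀ u : SqSeq, D.H u - z • u = φ →
      ‖u n‖ ≤ B) :
    ‖D.evolve t φ n‖ ≤ r * (Real.exp (t * h) * B) := by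
  have hnt : Nontrivial SqSeq :=
    ⟨lp.single 2 0 1, 0, fun h => by
      have := congrArg (fun u : SqSeq => u 0) h
      simp at this⟩
  set c : ℂ := -(Complex.I * Y) with hc
  set s : ℂ := -(Complex.I * t) with hs
  have hlt := (D.norm_H_add_le Y).trans_lt hr
  rw [← hc] at hlt
  have hr0 : 0 < r := (norm_nonneg _).trans_lt hlt
  have hmem : ∀ z ∈ Metric.sphere c r, z ∈ resolventSet ℂ D.H := by
    intro z hz
    have hzc : ‖z - c‖ = r := by simpa [dist_eq_norm] using hz
    have h1 : z - c ∈ resolventSet ℂ (D.H - algebraMap ℂ (SqSeq →L[ℂ] SqSeq) c) :=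
      spectrum.mem_resolventSet_of_norm_lt (by rw [hzc]; exact hlt)
    rw [spectrum.mem_resolventSet_iff] at h1 ⊢
    rwa [map_sub, sub_sub_sub_cancel_right] at h1
  have hcauchy := circleIntegral_exp_smul_resolvent D.H c s hlt
  set L : (SqSeq →L[ℂ] SqSeq) →L[ℂ] ℂ :=
    (lp.evalCLM ℂ (fun _ : ℤ => ℂ) 2 n).comp (ContinuousLinearMap.apply ℂ SqSeq φ) with hL
  have hcont : ContinuousOn (fun z => Complex.exp (s * z) • resolvent D.H z)
      (Metric.sphere c r) := by
    intro z hz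
    refine ContinuousAt.continuousWithinAt ?_
    exact (Complex.continuous_exp.comp (continuous_const.mul continuous_id)).continuousAt.smul
      (spectrum.hasDerivAt_resolvent_const_left (hmem z hz)).continuousAt
  have hLint : L (∮ z in C(c, r), Complex.exp (s * z) • resolvent D.H z) =
      ∮ z in C(c, r), Complex.exp (s * z) * (resolvent D.H z φ) n := by
    rw [circleIntegral, ← ContinuousLinearMap.intervalIntegral_comp_comm]
    · rfl
    · exact (hcont.circleIntegrable hr0.le).out
  have hev : D.evolve t φ n = (2 * (Real.pi : ℂ) * Complex.I)⁻¹ •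
      ∮ z in C(c, r), Complex.exp (s * z) * (resolvent D.H z φ) n := by
    rw [← hLint, hcauchy, map_smul, smul_smul, inv_mul_cancel₀ Complex.two_pi_I_ne_zero, one_smul]
    rfl
  rw [hev]
  refine circleIntegral.norm_two_pi_i_inv_smul_integral_le_of_norm_le_const hr0.le fun z hz => ?_
  rw [norm_mul]
  have h1 : ‖Complex.exp (s * z)‖ ≤ Real.exp (t * h) := by
    rw [Complex.norm_exp]
    have : (s * z).re = t * z.im := by simp [hs]
    rw [this, Real.exp_le_exp]
    exact mul_le_mul_of_nonneg_left (hh z hz) ht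
  have h2 : ‖(resolvent D.H z φ) n‖ ≤ B := by
    -- The sign is due to the convention `resolvent D.H z = (z - H)⁻¹`.
    have h3 := hres z hz (-(resolvent D.H z φ)) (by
      have h4 : (algebraMap ℂ (SqSeq →L[ℂ] SqSeq) z - D.H) * resolvent D.H z = 1 :=
        Ring.mul_inverse_cancel _ (spectrum.mem_resolventSet_iff.1 (hmem z hz))
      have h5 : z • resolvent D.H z φ - D.H (resolvent D.H z φ) = φ :=
        congrArg (fun T : SqSeq →L[ℂ] SqSeq => T φ) h4
      rw [map_neg, smul_neg, neg_sub_neg]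
      exact h5)
    simpa using h3
  gcongr

/-- With `Y = 4 K² T` the equation of the circle reads `v (v + 2Y) = 4K² - a²`, which lies between
`3K²` and `4K²`; this pins `v` between `1/(4T)` and `1/(2T)`. -/
theorem im_bounds_of_mem_circle {K T a v : ℝ} (hK : 1 ≤ K) (hT : 1 ≤ T)
    (h : a ^ 2 + (v + 4 * K ^ 2 * T) ^ 2 = (4 * K ^ 2 * T) ^ 2 + 4 * K ^ 2) (ha : |a| ≤ K)
    (hv : 0 ≤ v + 4 * K ^ 2 * T) : 0 < v ∧ v ≤ 1 / (2 * T) ∧ 1 / v ≤ 4 * T := by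
  have hK2 : 1 ≤ K ^ 2 := one_le_pow₀ hK
  have ha2 : a ^ 2 ≤ K ^ 2 := sq_le_sq' (abs_le.1 ha).1 (abs_le.1 ha).2
  set Y := 4 * K ^ 2 * T with hY
  have hYT : 4 ≤ Y := by rw [hY]; nlinarith
  have hprod : v * (v + 2 * Y) = 4 * K ^ 2 - a ^ 2 := by linarith
  have hv0 : 0 < v := by
    by_contra hneg
    have : v * (v + 2 * Y) ≤ 0 := mul_nonpos_of_nonpos_of_nonneg (not_lt.1 hneg) (by linarith)
    linarith
  have hv1 : v ≤ 1 / (2 * T) := by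
    rw [le_div_iff₀ (by positivity)]
    have h5 : 4 * K ^ 2 * (v * (2 * T)) ≤ 4 * K ^ 2 * 1 := by
      have : v * (2 * Y) = 4 * K ^ 2 * (v * (2 * T)) := by rw [hY]; ring
      linarith [sq_nonneg a, sq_nonneg v]
    exact le_of_mul_le_mul_left h5 (by positivity)
  refine ⟨hv0, hv1, ?_⟩
  have hT2 : 1 / (2 * T) ≤ 1 / 2 := by
    gcongr
    linarith
  rw [div_le_iff₀ hv0]
  have h5 : 3 * K ^ 2 * 1 ≤ 3 * K ^ 2 * (4 * T * v) := by
    have h6 : v * (3 * Y) = 3 * K ^ 2 * (4 * T * v) := by rw [hY]; ring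
    have h7 : v * v ≤ v * Y := by gcongr; linarith
    linarith
  exact le_of_mul_le_mul_left h5 (by positivity)

/-- Arbitrarily fast polynomial decay of the evolution, on time scale `T`, up to powers of `T`. -/
theorem exists_evolve_decay (D : LongRangeData) {K : ℝ}
    (hK : spectrum ℂ D.H ⊆ (fun x : ℝ => (x : ℂ)) '' Set.Icc (-K + 1) (K - 1))
    {δ : ℝ} (hδ : 0 < δ) (N₀ : ℕ)
    (hG : ∀ E ε : ℝ, |E| ≤ K → 0 < ε → ε ≤ δ → ∀ N : ℕ, N₀ < N →
      (∃ x y : ℤ, (N : ℝ) / 4 ≤ (x : ℝ) ∧ (y : ℝ) ≤ (N : ℝ) / 2 ∧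
        D.GoodBox δ ((E : ℂ) + Complex.I * (ε : ℂ)) N (Finset.Icc x y)) ∧
      (∃ x y : ℤ, -((N : ℝ) / 2) ≤ (x : ℝ) ∧ (y : ℝ) ≤ -((N : ℝ) / 4) ∧
        D.GoodBox δ ((E : ℂ) + Complex.I * (ε : ℂ)) N (Finset.Icc x y)))
    (φ : SqSeq) (m : ℕ) (hφ : ∀ n : ℤ, (m : ℝ) < |(n : ℝ)| → φ n = 0) (M : ℕ) :
    ∃ (C T₀ : ℝ) (n₁ : ℕ), 0 ≤ C ∧ ∀ T : ℝ, T₀ ≤ T → ∀ t : ℝ, 0 ≤ t → ∀ n : ℤ, n₁ ≤ n.natAbs →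
      ‖D.evolve t φ n‖ ≤ C * T ^ 4 * Real.exp (t / (2 * T)) * (|(n : ℝ)| ^ M)⁻¹ := by
  obtain ⟨hK1, hHK⟩ := D.one_le_and_norm_H_le hK
  obtain ⟨C₁, n₁, hC₁, H₁⟩ := D.exists_resolvent_decay hδ N₀ hG φ m hφ M
  obtain ⟨θ, hθ, H₂⟩ := D.exists_combesThomas
  obtain ⟨C₂, hC₂, H₃⟩ := Real.exists_exp_neg_mul_rpow_le hθ one_pos M
  set C₃ := 2 * Real.exp (θ * m) * ‖φ‖ * C₂ with hC₃
  have hC₃0 : 0 ≤ C₃ := by positivity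
  -- The factor `4K² + 1` bounds `r / T`, and `64 T³` comes from `(1 / Im z)³ ≤ (4T)³`. The
  -- threshold `n₁ + 1` excludes `n = 0`.
  refine ⟨(4 * K ^ 2 + 1) * (64 * C₁ + C₃), max 1 (1 / δ), n₁ + 1, by positivity, ?_⟩
  intro T hT t ht n hn
  have hT1 : 1 ≤ T := (le_max_left _ _).trans hT
  have hTδ : 1 / T ≤ δ := by
    rw [div_le_iff₀ (by positivity)]
    have := (le_max_right _ _).trans hT
    rw [div_le_iff₀ hδ] at this
    linarith
  have hT0 : 0 < T := by linarith
  set Y := 4 * K ^ 2 * T with hY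
  have hK2 : 1 ≤ K ^ 2 := one_le_pow₀ hK1
  have hYT : 4 ≤ Y := by rw [hY]; nlinarith
  have hKY : K ≤ Y := by rw [hY]; nlinarith
  -- This circle meets the real axis at `±2K` and rises at most `1/(2T)` above it.
  set r := Real.sqrt (Y ^ 2 + 4 * K ^ 2) with hr
  have hr2 : r ^ 2 = Y ^ 2 + 4 * K ^ 2 := Real.sq_sqrt (by positivity)
  have hr0 : 0 ≤ r := Real.sqrt_nonneg _
  have hrY : r ≤ Y + 1 / (2 * T) := by
    have h1 : (Y + 1 / (2 * T)) ^ 2 = Y ^ 2 + 4 * K ^ 2 + (1 / (2 * T)) ^ 2 := by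
      rw [hY]; field_simp; ring
    refine le_of_sq_le_sq ?_ (by positivity)
    rw [h1, hr2]
    linarith [sq_nonneg (1 / (2 * T))]
  have hT2 : 1 / (2 * T) ≤ 1 / 2 := by
    gcongr
    linarith
  have hrT : r ≤ (4 * K ^ 2 + 1) * T := by
    have : (4 * K ^ 2 + 1) * T = Y + T := by rw [hY]; ring
    linarith
  have hlt : Real.sqrt (Y ^ 2 + ‖D.H‖ ^ 2) < r := by
    refine Real.sqrt_lt_sqrt (by positivity) ?_
    have : ‖D.H‖ ^ 2 ≤ (K - 1) ^ 2 := by gcongr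
    nlinarith
  set P := (|(n : ℝ)| ^ M)⁻¹ with hP
  have hP0 : 0 ≤ P := by positivity
  have hn1 : (1 : ℝ) ≤ |(n : ℝ)| := by
    have : 1 ≤ |n| := Int.one_le_abs (by omega)
    exact_mod_cast this
  have hCT : ∀ z : ℂ, (∀ v : SqSeq, ‖v‖ ≤ ‖D.H v - z • v‖) → ∀ u : SqSeq,
      D.H u - z • u = φ → ‖u n‖ ≤ (64 * C₁ + C₃) * T ^ 3 * P := by
    intro z hz u hu
    have h1 := H₂ z φ u m hz hφ (by positivity) hu n
    have h2 := H₃ _ hn1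
    rw [Real.rpow_one, Real.rpow_neg (by positivity), Real.rpow_natCast] at h2
    calc ‖u n‖ ≤ 2 * Real.exp (θ * m) * ‖φ‖ * Real.exp (-θ * |(n : ℝ)|) := h1
      _ ≤ 2 * Real.exp (θ * m) * ‖φ‖ * (C₂ * P) := by gcongr
      _ = C₃ * 1 * P := by rw [hC₃]; ring
      _ ≤ (64 * C₁ + C₃) * T ^ 3 * P := by
        gcongr
        · linarith
        · exact one_le_pow₀ hT1
  have hsph : ∀ z ∈ Metric.sphere (-(Complex.I * Y)) r,
      z.re ^ 2 + (z.im + Y) ^ 2 = Y ^ 2 + 4 * K ^ 2 := by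
    intro z hz
    have h1 : ‖z - -(Complex.I * Y)‖ = r := by simpa [dist_eq_norm] using hz
    rw [← hr2, ← h1, Complex.sq_norm, Complex.normSq_apply]
    simp
    ring
  have hmain := D.norm_evolve_apply_le_of_circle φ t n hlt ((64 * C₁ + C₃) * T ^ 3 * P)
    (1 / (2 * T)) ht (fun z hz => by
      have h1 := hsph z hz
      have h2 : z.im + Y ≤ r := by
        refine le_of_sq_le_sq ?_ hr0
        rw [hr2]; nlinarith [sq_nonneg z.re]
      linarith) (fun z hz u hu => by
      have h1 := hsph z hz
      rcases le_or_gt K |z.re| with hre | hre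
      -- Over `|Re z| ≥ K` the distance to `[-‖H‖, ‖H‖]` is at least one, since `‖H‖ ≤ K - 1`.
      · refine hCT z (fun v => ?_) u hu
        have h2 := D.re_mul_norm_le z v
        nlinarith [norm_nonneg v]
      have hre2 : z.re ^ 2 ≤ K ^ 2 := by
        rw [← sq_abs]; gcongr
      rcases lt_or_ge (z.im + Y) 0 with him | him
      · refine hCT z (fun v => ?_) u hu
        have h2 := D.im_mul_norm_le z v
        have h3 : 1 ≤ |z.im| := by
          rw [abs_of_neg (by linarith)]; linarith
        nlinarith [norm_nonneg v]
      obtain ⟨hv0, hv1, hv2⟩ := im_bounds_of_mem_circle hK1 hT1 (by rwa [← hY]) hre.le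
        (by rwa [← hY])
      have hv3 : z.im ≤ 1 / T := hv1.trans (by gcongr; linarith)
      have h7 := H₁ z hre.le hv0 (hv3.trans hTδ) (by linarith) u hu n (by omega)
      calc ‖u n‖ ≤ C₁ * (1 / z.im) ^ 3 * P := h7
        _ ≤ C₁ * (4 * T) ^ 3 * P := by gcongr
        _ = 64 * C₁ * T ^ 3 * P := by ring
        _ ≤ _ := by gcongr; linarith)
  calc _ ≤ r * (Real.exp (t * (1 / (2 * T))) * ((64 * C₁ + C₃) * T ^ 3 * P)) := hmain
    _ ≤ ((4 * K ^ 2 + 1) * T) *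
        (Real.exp (t * (1 / (2 * T))) * ((64 * C₁ + C₃) * T ^ 3 * P)) := by gcongr
    _ = _ := by rw [mul_one_div]; ring

end LongRangeData

/-! ### Upper bound for the moments and the exponent. -/

theorem lintegral_ofReal_exp_Ioi {a : ℝ} (ha : 0 < a) :
    ∫⁻ t in Set.Ioi (0 : ℝ), ENNReal.ofReal (Real.exp (-a * t)) = ENNReal.ofReal (1 / a) := by
  rw [← MeasureTheory.ofReal_integral_eq_lintegral_ofReal
    (integrableOn_exp_mul_Ioi (neg_lt_zero.2 ha) 0)
    (Filter.Eventually.of_forall fun _ => (Real.exp_pos _).le),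
    integral_exp_mul_Ioi (neg_lt_zero.2 ha)]
  simp [neg_div_neg_eq]

theorem SqSeq.tsum_ofReal_norm_sq (u : SqSeq) :
    ∑' n : ℤ, ENNReal.ofReal (‖u n‖ ^ 2) = ENNReal.ofReal (‖u‖ ^ 2) := by
  rw [← u.hasSum_norm_sq.tsum_eq,
    ENNReal.ofReal_tsum_of_nonneg (fun _ => by positivity) u.hasSum_norm_sq.summable]

theorem SqSeq.exists_nat_forall_eq_zero (φ : SqSeq)
    (hφ : (Function.support (fun n : ℤ => φ n)).Finite) :
    ∃ m : ℕ, ∀ n : ℤ, (m : ℝ) < |(n : ℝ)| → φ n = 0 := by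
  obtain ⟨m, hm⟩ := (hφ.image Int.natAbs).bddAbove
  refine ⟨m, fun n hn => ?_⟩
  by_contra h
  have h1 : n.natAbs ≤ m := hm ⟨n, h, rfl⟩
  have h2 : ((n.natAbs : ℕ) : ℝ) ≤ m := by exact_mod_cast h1
  rw [Nat.cast_natAbs, Int.cast_abs] at h2
  linarith

namespace LongRangeData

theorem evolve_mem_unitary (D : LongRangeData) (t : ℝ) :
    NormedSpace.exp ((-(Complex.I * (t : ℂ))) • D.H) ∈ unitary (SqSeq →L[ℂ] SqSeq) := by
  let := NormedAlgebra.restrictScalars ℚ ℂ (SqSeq →L[ℂ] SqSeq)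
  refine NormedSpace.exp_mem_unitary_of_mem_skewAdjoint ?_
  refine D.isSelfAdjoint_H.smul_mem_skewAdjoint ?_
  rw [skewAdjoint.mem_iff]
  simp

theorem norm_evolve (D : LongRangeData) (t : ℝ) (φ : SqSeq) : ‖D.evolve t φ‖ = ‖φ‖ :=
  ContinuousLinearMap.norm_map_of_mem_unitary (D.evolve_mem_unitary t) φ

/-- The moments grow slower than any power of `T`. -/
theorem exists_moment_le (D : LongRangeData) {K : ℝ}
    (hK : spectrum ℂ D.H ⊆ (fun x : ℝ => (x : ℂ)) '' Set.Icc (-K + 1) (K - 1))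
    {δ : ℝ} (hδ : 0 < δ) (N₀ : ℕ)
    (hG : ∀ E ε : ℝ, |E| ≤ K → 0 < ε → ε ≤ δ → ∀ N : ℕ, N₀ < N →
      (∃ x y : ℤ, (N : ℝ) / 4 ≤ (x : ℝ) ∧ (y : ℝ) ≤ (N : ℝ) / 2 ∧
        D.GoodBox δ ((E : ℂ) + Complex.I * (ε : ℂ)) N (Finset.Icc x y)) ∧
      (∃ x y : ℤ, -((N : ℝ) / 2) ≤ (x : ℝ) ∧ (y : ℝ) ≤ -((N : ℝ) / 4) ∧
        D.GoodBox δ ((E : ℂ) + Complex.I * (ε : ℂ)) N (Finset.Icc x y)))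
    (φ : SqSeq) (hφ : (Function.support (fun n : ℤ => φ n)).Finite)
    {p : ℝ} (hp : 0 < p) {s : ℝ} (hs : 0 < s) :
    ∃ C T₀ : ℝ, 0 ≤ C ∧ ∀ T : ℝ, T₀ ≤ T → D.moment φ p T ≤ ENNReal.ofReal (C * T ^ (s * p)) := by
  obtain ⟨m, hm⟩ := φ.exists_nat_forall_eq_zero hφ
  -- For `|n| > T^s` one has `T⁸ ≤ |n|^{8/s}`, so this `M` pays for `T⁸` and `|n|^p` and leaves the
  -- summable `|n|⁻²`.
  obtain ⟨M, hM⟩ := exists_nat_ge (p + 2 + 8 / s)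
  obtain ⟨C, T₀, n₁, hC, H⟩ := D.exists_evolve_decay hK hδ N₀ hG φ m hm M
  have hsum : Summable (fun n : ℤ => 1 / (n : ℝ) ^ 2) := Real.summable_one_div_int_pow.2 one_lt_two
  set Z := ∑' n : ℤ, 1 / (n : ℝ) ^ 2 with hZ
  have hZ0 : 0 ≤ Z := tsum_nonneg fun _ => by positivity
  refine ⟨2 * (‖φ‖ ^ 2 + C ^ 2 * Z), max (max 1 T₀) (((n₁ : ℝ) + 1) ^ (1 / s)), by positivity, ?_⟩
  intro T hT
  have hT1 : 1 ≤ T := ((le_max_left _ _).trans (le_max_left _ _)).trans hT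
  have hTT : T₀ ≤ T := ((le_max_right _ _).trans (le_max_left _ _)).trans hT
  have hT0 : 0 < T := by linarith
  have hTn : (n₁ : ℝ) + 1 ≤ T ^ s := by
    have h1 := Real.rpow_le_rpow (by positivity) ((le_max_right _ _).trans hT) hs.le
    rwa [← Real.rpow_mul (by positivity), one_div, inv_mul_cancel₀ hs.ne', Real.rpow_one] at h1
  have hterm : ∀ t : ℝ, 0 < t → ∀ n : ℤ, |(n : ℝ)| ^ p * ‖D.evolve t φ n‖ ^ 2 ≤
      T ^ (s * p) * ‖D.evolve t φ n‖ ^ 2 + C ^ 2 * Real.exp (t / T) * (1 / (n : ℝ) ^ 2) := by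
    intro t ht n
    rcases le_or_gt |(n : ℝ)| (T ^ s) with hn | hn
    · have h1 : |(n : ℝ)| ^ p ≤ T ^ (s * p) := by
        rw [Real.rpow_mul hT0.le]
        exact Real.rpow_le_rpow (abs_nonneg _) hn hp.le
      have h2 : 0 ≤ C ^ 2 * Real.exp (t / T) * (1 / (n : ℝ) ^ 2) := by positivity
      have h3 := mul_le_mul_of_nonneg_right h1 (sq_nonneg ‖D.evolve t φ n‖)
      linarith
    · set x := |(n : ℝ)| with hx
      have hx1 : 1 ≤ x := by linarith [(Nat.cast_nonneg n₁ : (0 : ℝ) ≤ n₁)]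
      have hx0 : 0 < x := by linarith
      have hnn : n₁ ≤ n.natAbs := by
        have : (n₁ : ℝ) ≤ (n.natAbs : ℝ) := by
          rw [Nat.cast_natAbs, Int.cast_abs]
          linarith
        exact_mod_cast this
      have h1 := H T hTT t ht.le n hnn
      have h2 : ‖D.evolve t φ n‖ ^ 2 ≤ C ^ 2 * T ^ 8 * Real.exp (t / T) * (x ^ (2 * M))⁻¹ := by
        calc _ ≤ (C * T ^ 4 * Real.exp (t / (2 * T)) * (x ^ M)⁻¹) ^ 2 := by gcongr
          _ = C ^ 2 * T ^ 8 * (Real.exp (t / (2 * T)) * Real.exp (t / (2 * T))) *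
              ((x ^ M)⁻¹ * (x ^ M)⁻¹) := by ring
          _ = _ := by
            rw [← Real.exp_add, ← mul_inv, ← pow_add, two_mul M]
            congr 3
            field_simp
            ring_nf
      have h3 : T ^ 8 ≤ x ^ (8 / s) := by
        calc T ^ 8 = (T ^ s) ^ (8 / s) := by
              rw [← Real.rpow_mul hT0.le, mul_div_cancel₀ _ hs.ne']
              norm_cast
          _ ≤ _ := Real.rpow_le_rpow (by positivity) hn.le (by positivity)
      have h4 : x ^ p * (T ^ 8 * (x ^ (2 * M))⁻¹) ≤ 1 / (n : ℝ) ^ 2 := by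
        rw [← sq_abs, ← hx]
        calc _ ≤ x ^ p * (x ^ (8 / s) * (x ^ (2 * M))⁻¹) := by gcongr
          _ = x ^ (p + 8 / s) / x ^ (2 * M) := by rw [Real.rpow_add hx0]; ring
          _ ≤ 1 / x ^ 2 := by
            rw [div_le_div_iff₀ (by positivity) (by positivity), one_mul, ← Real.rpow_natCast,
              ← Real.rpow_natCast, ← Real.rpow_add hx0]
            refine Real.rpow_le_rpow_of_exponent_le hx1 ?_
            push_cast
            linarith [(Nat.cast_nonneg M : (0 : ℝ) ≤ M)]
      calc _ ≤ x ^ p * (C ^ 2 * T ^ 8 * Real.exp (t / T) * (x ^ (2 * M))⁻¹) := by gcongr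
        _ = C ^ 2 * Real.exp (t / T) * (x ^ p * (T ^ 8 * (x ^ (2 * M))⁻¹)) := by ring
        _ ≤ C ^ 2 * Real.exp (t / T) * (1 / (n : ℝ) ^ 2) := by gcongr
        _ ≤ _ := by
          have : 0 ≤ T ^ (s * p) * ‖D.evolve t φ n‖ ^ 2 := by positivity
          linarith
  set W := T ^ (s * p) * (‖φ‖ ^ 2 + C ^ 2 * Z) with hW
  have hW0 : 0 ≤ W := by positivity
  have hTs : 1 ≤ T ^ (s * p) := Real.one_le_rpow hT1 (by positivity)
  have htsum : ∀ t : ℝ, 0 < t → ∑' n : ℤ, ENNReal.ofReal (|(n : ℝ)| ^ p * ‖D.evolve t φ n‖ ^ 2) ≤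
      ENNReal.ofReal (Real.exp (t / T) * W) := by
    intro t ht
    have hsm := ((D.evolve t φ).hasSum_norm_sq.mul_left (T ^ (s * p))).add
      (hsum.hasSum.mul_left (C ^ 2 * Real.exp (t / T)))
    calc _ ≤ ∑' n : ℤ, ENNReal.ofReal (T ^ (s * p) * ‖D.evolve t φ n‖ ^ 2 +
          C ^ 2 * Real.exp (t / T) * (1 / (n : ℝ) ^ 2)) :=
          ENNReal.tsum_le_tsum fun n => ENNReal.ofReal_le_ofReal (hterm t ht n)
      _ = ENNReal.ofReal (T ^ (s * p) * ‖φ‖ ^ 2 + C ^ 2 * Real.exp (t / T) * Z) := by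
          rw [← ENNReal.ofReal_tsum_of_nonneg (fun _ => by positivity) hsm.summable, hsm.tsum_eq,
            D.norm_evolve]
      _ ≤ _ := by
          refine ENNReal.ofReal_le_ofReal ?_
          have he : 1 ≤ Real.exp (t / T) := Real.one_le_exp (by positivity)
          calc _ = 1 * (T ^ (s * p) * ‖φ‖ ^ 2) + Real.exp (t / T) * (1 * (C ^ 2 * Z)) := by ring
            _ ≤ Real.exp (t / T) * (T ^ (s * p) * ‖φ‖ ^ 2) +
                Real.exp (t / T) * (T ^ (s * p) * (C ^ 2 * Z)) := by gcongr
            _ = _ := by rw [hW]; ring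
  -- The growth `e^{t/T}` of the squared bound is half of what the weight `e^{-2t/T}` can absorb.
  calc D.moment φ p T ≤ ENNReal.ofReal (2 / T) * ∫⁻ t in Set.Ioi (0 : ℝ),
        ENNReal.ofReal W * ENNReal.ofReal (Real.exp (-(1 / T) * t)) := by
        rw [moment]
        gcongr 1
        refine MeasureTheory.setLIntegral_mono' measurableSet_Ioi fun t ht => ?_
        refine (mul_le_mul_right (htsum t ht) _).trans (le_of_eq ?_)
        rw [← ENNReal.ofReal_mul (Real.exp_pos _).le, ← ENNReal.ofReal_mul hW0, ← mul_assoc,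
          ← Real.exp_add, mul_comm]
        congr 3
        field_simp
        ring
    _ = ENNReal.ofReal (2 / T) * (ENNReal.ofReal W * ENNReal.ofReal T) := by
        rw [MeasureTheory.lintegral_const_mul' _ _ ENNReal.ofReal_ne_top,
          lintegral_ofReal_exp_Ioi (by positivity), one_div_one_div]
    _ = _ := by
        rw [← ENNReal.ofReal_mul hW0, ← ENNReal.ofReal_mul (by positivity)]
        congr 1
        rw [hW]
        field_simp

theorem upperExponent_le_zero_of_moment_le (D : LongRangeData) (φ : SqSeq) {p : ℝ} (hp : 0 < p)
    (h : ∀ s : ℝ, 0 < s → ∃ C T₀ : ℝ, 0 ≤ C ∧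
      ∀ T : ℝ, T₀ ≤ T → D.moment φ p T ≤ ENNReal.ofReal (C * T ^ (s * p))) :
    D.upperExponent φ p ≤ 0 := by
  refine EReal.le_of_forall_lt_iff_le.1 fun r hr => ?_
  have hr0 : 0 < r := by exact_mod_cast hr
  -- Half of the exponent is kept in reserve: the other factor `T^{rp/2}` swallows `C` for large
  -- `T`.
  obtain ⟨C, T₀, hC, H⟩ := h (r / 2) (by positivity)
  refine Filter.limsup_le_of_le (by isBoundedDefault) ?_
  have hlim : Filter.Tendsto (fun T : ℝ => T ^ (r / 2 * p)) Filter.atTop Filter.atTop :=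
    tendsto_rpow_atTop (by positivity)
  filter_upwards [Filter.eventually_ge_atTop T₀, Filter.eventually_gt_atTop 1,
    hlim.eventually_ge_atTop C] with T h1 h2 h3
  have hT0 : 0 < T := by linarith
  have hlog : 0 < p * Real.log T := mul_pos hp (Real.log_pos h2)
  have h4 : D.moment φ p T ≤ ENNReal.ofReal (T ^ (r * p)) := by
    refine (H T h1).trans (ENNReal.ofReal_le_ofReal ?_)
    calc _ ≤ T ^ (r / 2 * p) * T ^ (r / 2 * p) := by gcongr
      _ = _ := by rw [← Real.rpow_add hT0]; ring_nf
  have h5 := ENNReal.log_le_log h4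
  rw [ENNReal.log_ofReal_of_pos (by positivity), Real.log_rpow hT0] at h5
  rw [EReal.div_le_iff_le_mul (by exact_mod_cast hlog) (EReal.coe_ne_top _)]
  refine h5.trans (le_of_eq ?_)
  rw [← EReal.coe_mul]
  congr 1
  ring

theorem zero_le_upperExponent_of_le_moment (D : LongRangeData) (φ : SqSeq) {p : ℝ} (hp : 0 < p)
    {c : ℝ} (hc : 0 < c) (h : ∀ T : ℝ, 1 ≤ T → ENNReal.ofReal c ≤ D.moment φ p T) :
    0 ≤ D.upperExponent φ p := by
  refine EReal.ge_of_forall_gt_iff_ge.1 fun r hr => ?_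
  have hr0 : r < 0 := by exact_mod_cast hr
  refine Filter.le_limsup_of_frequently_le ?_ (by isBoundedDefault)
  refine Filter.Eventually.frequently ?_
  have hlim : Filter.Tendsto (fun T : ℝ => T ^ (-r * p)) Filter.atTop Filter.atTop :=
    tendsto_rpow_atTop (mul_pos (neg_pos.2 hr0) hp)
  filter_upwards [Filter.eventually_gt_atTop 1, hlim.eventually_ge_atTop (1 / c)] with T h2 h3
  have hT0 : 0 < T := by linarith
  have hlog : 0 < p * Real.log T := mul_pos hp (Real.log_pos h2)
  have h4 : ENNReal.ofReal (T ^ (r * p)) ≤ D.moment φ p T := by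
    refine (ENNReal.ofReal_le_ofReal ?_).trans (h T h2.le)
    rw [neg_mul, Real.rpow_neg hT0.le, one_div] at h3
    exact (inv_le_inv₀ hc (by positivity)).1 h3
  have h5 := ENNReal.log_le_log h4
  rw [ENNReal.log_ofReal_of_pos (by positivity), Real.log_rpow hT0] at h5
  rw [EReal.le_div_iff_mul_le (by exact_mod_cast hlog) (EReal.coe_ne_top _)]
  refine le_trans (le_of_eq ?_) h5
  rw [← EReal.coe_mul]
  congr 1
  ring

end LongRangeData

/-! ### Lower bound for the moments. -/

theorem exists_bound_ite (P : ℤ → Prop) [DecidablePred P] :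
    ∃ C : ℝ, ∀ n : ℤ, |(if P n then (1 : ℝ) else 0)| ≤ C :=
  ⟨1, fun n => by split_ifs <;> simp⟩

/-- Multiplication by the indicator function of a set of sites. -/
noncomputable def siteProj (P : ℤ → Prop) [DecidablePred P] : SqSeq →L[ℂ] SqSeq :=
  potentialOp (fun n => if P n then 1 else 0) (exists_bound_ite P)

theorem siteProj_apply (P : ℤ → Prop) [DecidablePred P] (u : SqSeq) (n : ℤ) :
    siteProj P u n = if P n then u n else 0 := by
  rw [siteProj, potentialOp_apply]
  split_ifs <;> simp

theorem norm_siteProj_apply_le (P : ℤ → Prop) [DecidablePred P] (u : SqSeq) :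
    ‖siteProj P u‖ ≤ ‖u‖ :=
  SqSeq.norm_le_of_norm_apply_le _ _ fun n => by
    rw [siteProj_apply]
    split_ifs <;> simp

theorem SqSeq.eq_single_add_siteProj (u : SqSeq) (i : ℤ) :
    u = u i • (lp.single 2 i (1 : ℂ) : SqSeq) + siteProj (· ≠ i) u := by
  ext n
  rw [lp.coeFn_add, Pi.add_apply, siteProj_apply, lp.coeFn_smul, Pi.smul_apply, lp.single_apply]
  by_cases h : n = i
  · subst h; simp
  · simp [h]

/-- Shifting time by `s` changes the weight by `e^{2s/T} ≤ e^{2s}` and only discards the interval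
`(0, s]`, so `f (t + s)` can be replaced by `f t` under the integral at a cost uniform in `T ≥ 1`.
-/
theorem mul_le_lintegral_exp_of_le_shift {f : ℝ → ℝ} (hf : Measurable f) (hf0 : ∀ t, 0 ≤ f t)
    {c κ₁ κ₂ s T : ℝ} (hκ₁ : 0 ≤ κ₁) (hκ₂ : 0 ≤ κ₂) (hs : 0 ≤ s) (hT : 1 ≤ T)
    (h : ∀ t, 0 < t → c ≤ κ₁ * f t + κ₂ * f (t + s)) :
    ENNReal.ofReal (c * (T / 2)) ≤ ENNReal.ofReal (κ₁ + κ₂ * Real.exp (2 * s)) *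
      ∫⁻ t in Set.Ioi (0 : ℝ), ENNReal.ofReal (Real.exp (-2 * t / T)) * ENNReal.ofReal (f t) := by
  have hT0 : 0 < T := by linarith
  set g : ℝ → ℝ≥0∞ := fun t => ENNReal.ofReal (Real.exp (-2 * t / T)) * ENNReal.ofReal (f t) with hg
  have hgm : Measurable g := by fun_prop
  have hshift : ∫⁻ t in Set.Ioi (0 : ℝ), g (t + s) ≤ ∫⁻ t in Set.Ioi (0 : ℝ), g t := by
    have h1 := (MeasureTheory.measurePreserving_add_right MeasureTheory.volume s).setLIntegral_comp_preimage
      (measurableSet_Ioi (a := s)) hgm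
    have h2 : (fun x : ℝ => x + s) ⁻¹' Set.Ioi s = Set.Ioi 0 := by
      ext x; simp
    rw [h2] at h1
    rw [h1]
    exact MeasureTheory.lintegral_mono_set (Set.Ioi_subset_Ioi hs)
  have hpt : ∀ t : ℝ, 0 < t → ENNReal.ofReal c * ENNReal.ofReal (Real.exp (-(2 / T) * t)) ≤
      ENNReal.ofReal κ₁ * g t + ENNReal.ofReal (κ₂ * Real.exp (2 * s)) * g (t + s) := by
    intro t ht
    have e1 : Real.exp (-2 * t / T) ≤ Real.exp (2 * s) * Real.exp (-2 * (t + s) / T) := by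
      rw [← Real.exp_add, Real.exp_le_exp]
      have : s / T ≤ s := div_le_self hs hT
      have e2 : -2 * (t + s) / T = -2 * t / T - 2 * (s / T) := by ring
      rw [e2]; linarith
    have e3 : -(2 / T) * t = -2 * t / T := by ring
    simp only [hg]
    rw [e3, ← ENNReal.ofReal_mul' (Real.exp_pos _).le, ← ENNReal.ofReal_mul (Real.exp_pos _).le,
      ← ENNReal.ofReal_mul (Real.exp_pos _).le, ← ENNReal.ofReal_mul hκ₁,
      ← ENNReal.ofReal_mul (by positivity), ← ENNReal.ofReal_add
        (mul_nonneg hκ₁ (mul_nonneg (Real.exp_pos _).le (hf0 _)))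
        (mul_nonneg (by positivity) (mul_nonneg (Real.exp_pos _).le (hf0 _)))]
    refine ENNReal.ofReal_le_ofReal ?_
    calc c * Real.exp (-2 * t / T) ≤ (κ₁ * f t + κ₂ * f (t + s)) * Real.exp (-2 * t / T) := by
          gcongr; exact h t ht
      _ = κ₁ * (Real.exp (-2 * t / T) * f t) + κ₂ * f (t + s) * Real.exp (-2 * t / T) := by ring
      _ ≤ κ₁ * (Real.exp (-2 * t / T) * f t) +
          κ₂ * f (t + s) * (Real.exp (2 * s) * Real.exp (-2 * (t + s) / T)) := by
          have := mul_nonneg hκ₂ (hf0 (t + s))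
          gcongr
      _ = _ := by ring
  calc ENNReal.ofReal (c * (T / 2))
      = ∫⁻ t in Set.Ioi (0 : ℝ), ENNReal.ofReal c * ENNReal.ofReal (Real.exp (-(2 / T) * t)) := by
        rw [MeasureTheory.lintegral_const_mul' _ _ ENNReal.ofReal_ne_top,
          lintegral_ofReal_exp_Ioi (by positivity), one_div_div,
          ENNReal.ofReal_mul' (by positivity)]
    _ ≤ ∫⁻ t in Set.Ioi (0 : ℝ), (ENNReal.ofReal κ₁ * g t +
          ENNReal.ofReal (κ₂ * Real.exp (2 * s)) * g (t + s)) :=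
        MeasureTheory.setLIntegral_mono' measurableSet_Ioi fun t ht => hpt t ht
    _ = ENNReal.ofReal κ₁ * (∫⁻ t in Set.Ioi (0 : ℝ), g t) +
          ENNReal.ofReal (κ₂ * Real.exp (2 * s)) * ∫⁻ t in Set.Ioi (0 : ℝ), g (t + s) := by
        rw [MeasureTheory.lintegral_add_left (hgm.const_mul _),
          MeasureTheory.lintegral_const_mul' _ _ ENNReal.ofReal_ne_top,
          MeasureTheory.lintegral_const_mul' _ _ ENNReal.ofReal_ne_top]
    _ ≤ ENNReal.ofReal κ₁ * (∫⁻ t in Set.Ioi (0 : ℝ), g t) +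
          ENNReal.ofReal (κ₂ * Real.exp (2 * s)) * ∫⁻ t in Set.Ioi (0 : ℝ), g t := by gcongr
    _ = _ := by rw [← add_mul, ← ENNReal.ofReal_add hκ₁ (by positivity)]

namespace LongRangeData

theorem hasDerivAt_evolve_zero (D : LongRangeData) (φ : SqSeq) :
    HasDerivAt (fun t => D.evolve t φ) ((-Complex.I) • D.H φ) 0 := by
  have h1 := hasDerivAt_exp_smul_const (𝕂 := ℂ) ((-Complex.I) • D.H) ((0 : ℝ) : ℂ)
  have h2 := (ContinuousLinearMap.apply ℂ SqSeq φ).hasFDerivAt.comp_hasDerivAt _ h1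
  have h3 := h2.scomp (0 : ℝ) Complex.ofRealCLM.hasDerivAt
  simp only [Complex.ofReal_zero, zero_smul, NormedSpace.exp_zero, one_mul,
    Complex.ofRealCLM_apply, Complex.ofReal_one, one_smul] at h3
  refine (h3.congr_of_eventuallyEq (Filter.Eventually.of_forall fun t => ?_))
  change NormedSpace.exp ((-(Complex.I * (t : ℂ))) • D.H) φ =
    NormedSpace.exp ((t : ℂ) • (-Complex.I) • D.H) φ
  rw [smul_smul, mul_neg, mul_comm]

theorem continuous_evolve (D : LongRangeData) (φ : SqSeq) : Continuous fun t => D.evolve t φ := by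
  have h1 : Continuous fun t : ℝ => NormedSpace.exp ((-(Complex.I * (t : ℂ))) • D.H) := by
    let := NormedAlgebra.restrictScalars ℚ ℂ (SqSeq →L[ℂ] SqSeq)
    exact NormedSpace.exp_continuous.comp (by fun_prop)
  exact h1.clm_apply continuous_const

theorem evolve_add (D : LongRangeData) (t s : ℝ) (φ : SqSeq) :
    D.evolve (t + s) φ = D.evolve s (D.evolve t φ) := by
  let := NormedAlgebra.restrictScalars ℚ ℂ (SqSeq →L[ℂ] SqSeq)
  have h : (-(Complex.I * ((t + s : ℝ) : ℂ))) • D.H =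
      (-(Complex.I * (s : ℂ))) • D.H + (-(Complex.I * (t : ℂ))) • D.H := by
    rw [← add_smul]; congr 1; push_cast; ring
  have hc : Commute ((-(Complex.I * (s : ℂ))) • D.H) ((-(Complex.I * (t : ℂ))) • D.H) :=
    ((Commute.refl D.H).smul_left _).smul_right _
  rw [evolve, h, NormedSpace.exp_add_of_commute hc]
  rfl

theorem evolve_vadd (D : LongRangeData) (t : ℝ) (c : ℂ) (φ ψ : SqSeq) :
    D.evolve t (c • φ + ψ) = c • D.evolve t φ + D.evolve t ψ := by
  simp only [evolve, map_add, map_smul]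

theorem le_moment (D : LongRangeData) (φ : SqSeq) {p : ℝ} (hp : 0 < p) (T : ℝ) :
    ENNReal.ofReal (2 / T) * ∫⁻ t in Set.Ioi (0 : ℝ), ENNReal.ofReal (Real.exp (-2 * t / T)) *
      ENNReal.ofReal (‖siteProj (· ≠ 0) (D.evolve t φ)‖ ^ 2) ≤ D.moment φ p T := by
  rw [moment]
  gcongr with t
  rw [← SqSeq.tsum_ofReal_norm_sq]
  refine ENNReal.tsum_le_tsum fun n => ENNReal.ofReal_le_ofReal ?_
  rw [siteProj_apply]
  by_cases hn : n = 0
  · rw [if_neg (not_not.2 hn), norm_zero, zero_pow two_ne_zero]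
    positivity
  · rw [if_pos hn]
    refine le_mul_of_one_le_left (sq_nonneg _) (Real.one_le_rpow ?_ hp.le)
    exact_mod_cast Int.one_le_abs hn

theorem exists_le_moment (D : LongRangeData) (φ : SqSeq) {p : ℝ} (hp : 0 < p) {c κ₁ κ₂ s : ℝ}
    (hc : 0 < c) (hκ₁ : 0 < κ₁) (hκ₂ : 0 ≤ κ₂) (hs : 0 ≤ s)
    (h : ∀ t, c ≤ κ₁ * ‖siteProj (· ≠ 0) (D.evolve t φ)‖ ^ 2 +
      κ₂ * ‖siteProj (· ≠ 0) (D.evolve (t + s) φ)‖ ^ 2) :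
    ∃ c' : ℝ, 0 < c' ∧ ∀ T : ℝ, 1 ≤ T → ENNReal.ofReal c' ≤ D.moment φ p T := by
  set κ := κ₁ + κ₂ * Real.exp (2 * s) with hκ
  have hκ0 : 0 < κ := by positivity
  refine ⟨c / κ, by positivity, fun T hT => ?_⟩
  have hT0 : 0 < T := by linarith
  refine le_trans ?_ (D.le_moment φ hp T)
  have hm : Measurable fun t => ‖siteProj (· ≠ 0) (D.evolve t φ)‖ ^ 2 :=
    (((siteProj (· ≠ 0)).continuous.comp (D.continuous_evolve φ)).norm.pow 2).measurable
  have h1 := mul_le_lintegral_exp_of_le_shift hm (fun _ => by positivity) hκ₁.le hκ₂ hs hT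
    (fun t _ => h t)
  rw [← hκ] at h1
  calc ENNReal.ofReal (c / κ) = ENNReal.ofReal (2 / T / κ) * ENNReal.ofReal (c * (T / 2)) := by
        rw [← ENNReal.ofReal_mul (by positivity)]
        congr 1
        field_simp
    _ ≤ _ := mul_le_mul_right h1 _
    _ = _ := by
        rw [← mul_assoc, ← ENNReal.ofReal_mul (by positivity), div_mul_cancel₀ _ hκ0.ne']

theorem H_single_apply (D : LongRangeData) {i k : ℤ} (hk : k ≠ i) :
    D.H (lp.single 2 i (1 : ℂ)) k = D.a (k - i) := by
  rw [H_apply, lp.single_apply, Pi.single_apply, if_neg hk, mul_zero, add_zero,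
    tsum_eq_single (k - i)]
  · simp
  · intro j hj
    rw [lp.single_apply, Pi.single_apply, if_neg, mul_zero]
    omega

/-- If `δ_0` never left the site `0`, the `k`-th component of its evolution would have right
derivative zero at time `0`; that derivative is `-i a_k`. -/
theorem exists_evolve_single_ne (D : LongRangeData) {k : ℤ} (hk : k ≠ 0) (ha : D.a k ≠ 0) :
    ∃ s : ℝ, 0 ≤ s ∧ siteProj (· ≠ 0) (D.evolve s (lp.single 2 0 (1 : ℂ))) ≠ 0 := by
  by_contra! hcon
  set δ₀ : SqSeq := lp.single 2 0 (1 : ℂ) with hδ₀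
  have h1 := (((lp.evalCLM ℂ (fun _ : ℤ => ℂ) 2 k).restrictScalars ℝ).hasFDerivAt.comp_hasDerivAt
    (0 : ℝ) (D.hasDerivAt_evolve_zero δ₀)).hasDerivWithinAt (s := Set.Ici 0)
  have h2 : HasDerivWithinAt (fun t : ℝ => (D.evolve t δ₀) k) 0 (Set.Ici 0) 0 := by
    refine (hasDerivWithinAt_const (0 : ℝ) (Set.Ici 0) (0 : ℂ)).congr_of_mem (fun t ht => ?_)
      Set.self_mem_Ici
    have h3 := congrArg (fun u : SqSeq => u k) (hcon t ht)
    simp only [siteProj_apply] at h3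
    rw [if_pos hk] at h3
    exact h3
  have h4 := (uniqueDiffWithinAt_Ici (0 : ℝ)).eq_deriv _ h1 h2
  have h5 : (-Complex.I) * D.H δ₀ k = 0 := h4
  rw [hδ₀, D.H_single_apply hk, sub_zero] at h5
  simp [ha] at h5

/-- Split `ψ = e^{-itH} φ` into `ψ_0 δ_0` and the part `Q ψ` off the origin. If `Q ψ` is small,
`|ψ_0|` is nearly `‖φ‖`, and during the next time `s` the component `ψ_0 δ_0` sends a fixed fraction
of its norm off the origin. -/
theorem exists_le_moment_of_hopping (D : LongRangeData) {φ : SqSeq} (hφ : φ ≠ 0) {k : ℤ}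
    (hk : k ≠ 0) (ha : D.a k ≠ 0) {p : ℝ} (hp : 0 < p) :
    ∃ c : ℝ, 0 < c ∧ ∀ T : ℝ, 1 ≤ T → ENNReal.ofReal c ≤ D.moment φ p T := by
  obtain ⟨s, hs, hne⟩ := D.exists_evolve_single_ne hk ha
  set Q : SqSeq →L[ℂ] SqSeq := siteProj (· ≠ 0) with hQ
  set κ := ‖Q (D.evolve s (lp.single 2 0 (1 : ℂ)))‖ with hκ
  have hκ0 : 0 < κ := norm_pos_iff.2 hne
  have hφ0 : 0 < ‖φ‖ := norm_pos_iff.2 hφ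
  refine D.exists_le_moment φ hp (c := (κ * ‖φ‖) ^ 2) (κ₁ := 2 * (1 + κ) ^ 2) (κ₂ := 2)
    (by positivity) (by positivity) (by positivity) hs fun t => ?_
  rw [← hQ]
  set ψ := D.evolve t φ with hψ
  have hdec := ψ.eq_single_add_siteProj 0
  rw [← hQ] at hdec
  have h1 : ‖φ‖ ≤ ‖ψ 0‖ + ‖Q ψ‖ := by
    rw [← D.norm_evolve t φ, ← hψ]
    calc ‖ψ‖ ≤ ‖ψ 0 • (lp.single 2 0 (1 : ℂ) : SqSeq)‖ + ‖Q ψ‖ := by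
          conv_lhs => rw [hdec]
          exact norm_add_le _ _
      _ = _ := by
        rw [norm_smul, lp.norm_single (E := fun _ : ℤ => ℂ) (p := 2) (by norm_num), norm_one,
          mul_one]
  have h2 : ‖ψ 0‖ * κ ≤ ‖Q (D.evolve (t + s) φ)‖ + ‖Q ψ‖ := by
    have h3 : ψ 0 • Q (D.evolve s (lp.single 2 0 (1 : ℂ))) =
        Q (D.evolve (t + s) φ) - Q (D.evolve s (Q ψ)) := by
      rw [D.evolve_add, ← hψ]
      conv_rhs => enter [1]; rw [hdec]
      rw [D.evolve_vadd, map_add, map_smul, add_sub_cancel_right]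
    calc ‖ψ 0‖ * κ = ‖ψ 0 • Q (D.evolve s (lp.single 2 0 (1 : ℂ)))‖ := by rw [norm_smul]
      _ ≤ ‖Q (D.evolve (t + s) φ)‖ + ‖Q (D.evolve s (Q ψ))‖ := by
        rw [h3]; exact norm_sub_le _ _
      _ ≤ ‖Q (D.evolve (t + s) φ)‖ + ‖Q ψ‖ := by
        gcongr
        exact (norm_siteProj_apply_le _ _).trans (D.norm_evolve s _).le
  set x := ‖Q ψ‖
  set y := ‖Q (D.evolve (t + s) φ)‖
  have h5 : κ * ‖φ‖ ≤ (1 + κ) * x + y := by nlinarith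
  calc (κ * ‖φ‖) ^ 2 ≤ ((1 + κ) * x + y) ^ 2 := by gcongr
    _ ≤ _ := by nlinarith [sq_nonneg ((1 + κ) * x - y)]

/-- Without hopping, `H` is a multiplication operator and commutes with the projection onto each
site, so the mass at `n` is conserved. -/
theorem exists_le_moment_of_diagonal (D : LongRangeData) (ha : ∀ k : ℤ, k ≠ 0 → D.a k = 0)
    {φ : SqSeq} {n : ℤ} (hn : n ≠ 0) (hφ : φ n ≠ 0) {p : ℝ} (hp : 0 < p) :
    ∃ c : ℝ, 0 < c ∧ ∀ T : ℝ, 1 ≤ T → ENNReal.ofReal c ≤ D.moment φ p T := by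
  have hφ0 : 0 < ‖φ n‖ := norm_pos_iff.2 hφ
  refine D.exists_le_moment φ hp (c := ‖φ n‖ ^ 2) (κ₁ := 1) (κ₂ := 0) (s := 0)
    (by positivity) one_pos le_rfl le_rfl fun t => ?_
  have hH : ∀ (u : SqSeq) (j : ℤ), D.H u j = (D.a 0 + D.V j) * u j := fun u j => by
    rw [H_apply, tsum_eq_single 0 (fun k hk => by rw [ha k hk, zero_mul]), sub_zero]
    ring
  have hcomm : Commute (siteProj (· = n)) D.H := by
    ext u j
    change siteProj (· = n) (D.H u) j = D.H (siteProj (· = n) u) j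
    rw [siteProj_apply, hH, hH, siteProj_apply]
    split_ifs <;> simp
  have hc2 : siteProj (· = n) (D.evolve t φ) = D.evolve t (siteProj (· = n) φ) := by
    let := NormedAlgebra.restrictScalars ℚ ℂ (SqSeq →L[ℂ] SqSeq)
    have := (hcomm.smul_right (-(Complex.I * (t : ℂ)))).exp_right
    exact congrArg (fun S : SqSeq →L[ℂ] SqSeq => S φ) this.eq
  have h1 : ‖φ n‖ ≤ ‖siteProj (· ≠ 0) (D.evolve t φ)‖ := by
    calc ‖φ n‖ = ‖siteProj (· = n) φ n‖ := by rw [siteProj_apply, if_pos rfl]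
      _ ≤ ‖siteProj (· = n) φ‖ := SqSeq.norm_apply_le _ _
      _ = ‖siteProj (· = n) (D.evolve t φ)‖ := by rw [hc2, D.norm_evolve]
      _ ≤ _ := SqSeq.norm_le_of_norm_apply_le _ _ fun j => by
        rw [siteProj_apply, siteProj_apply]
        by_cases hj : j = n
        · simp [hj, hn]
        · simp [hj]
  rw [one_mul, zero_mul, add_zero]
  gcongr

end LongRangeData

theorem theorem1p3 (D : LongRangeData) (K : ℝ)
    (hK : spectrum ℂ D.H ⊆ (fun x : ℝ => (x : ℂ)) '' Set.Icc (-K + 1) (K - 1))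
    (δ : ℝ) (hδ : 0 < δ) (N₀ : ℕ)
    (hG : ∀ E ε : ℝ, |E| ≤ K → 0 < ε → ε ≤ δ → ∀ N : ℕ, N₀ < N →
      (∃ x y : ℤ, (N : ℝ) / 4 ≤ (x : ℝ) ∧ (y : ℝ) ≤ (N : ℝ) / 2 ∧
        D.GoodBox δ ((E : ℂ) + Complex.I * (ε : ℂ)) N (Finset.Icc x y)) ∧
      (∃ x y : ℤ, -((N : ℝ) / 2) ≤ (x : ℝ) ∧ (y : ℝ) ≤ -((N : ℝ) / 4) ∧
        D.GoodBox δ ((E : ℂ) + Complex.I * (ε : ℂ)) N (Finset.Icc x y)))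
    (φ : SqSeq) (hφ : (Function.support (fun n : ℤ => φ n)).Finite)
    (p : ℝ) (hp : 0 < p) :
    D.upperExponent φ p ≤ 0 ∧
      ((φ ≠ 0 ∧ ((∃ n : ℤ, n ≠ 0 ∧ φ n ≠ 0) ∨ ∃ k : ℤ, k ≠ 0 ∧ D.a k ≠ 0)) →
        D.upperExponent φ p = 0) := by
  have hle : D.upperExponent φ p ≤ 0 := D.upperExponent_le_zero_of_moment_le φ hp fun s hs =>
    D.exists_moment_le hK hδ N₀ hG φ hφ hp hs
  refine ⟨hle, fun ⟨hφ0, hcase⟩ => le_antisymm hle ?_⟩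
  obtain ⟨c, hc, hmom⟩ : ∃ c : ℝ, 0 < c ∧ ∀ T : ℝ, 1 ≤ T → ENNReal.ofReal c ≤ D.moment φ p T := by
    by_cases ha : ∃ k : ℤ, k ≠ 0 ∧ D.a k ≠ 0
    · obtain ⟨k, hk, hak⟩ := ha
      exact D.exists_le_moment_of_hopping hφ0 hk hak hp
    · obtain ⟨n, hn, hφn⟩ := hcase.resolve_right ha
      push Not at ha
      exact D.exists_le_moment_of_diagonal ha hn hφn hp
  exact D.zero_le_upperExponent_of_le_moment φ hp hc hmom
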